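/- For complex $x,q$ and integers $n\ge 0$ write $(x;q)_n=\prod_{i=0}^{n-1}(1-xq^i)$, $(x_1,\dots,x_r;q)_n=\prod_{s=1}^r(x_s;q)_n$, $[n]_q=\frac{1-q^n}{1-q}$ and $\left[{n\atop m}\right]_q=\frac{(q;q)_n}{(q;q)_m(q;q)_{n-m}}$ for $0\le m\le n$. For a skew-symmetric matrix $A=(a_{i,j})_{i,j=0}^{2N-1}$ let $$\mathrm{Pf}(A)=\frac{1}{2^N N!}\sum_{\sigma}\mathrm{sgn}(\sigma)\prod_{i=0}^{N-1}a_{\sigma(2i),\sigma(2i+1)},$$ the sum running over all permutations $\sigma$ of $\{0,\dots,2N-1\}$. Let $N\ge 0$ be an integer and let $a,b,c,q\in\mathbb{C}$ with $0<|q|<1$, $c\ne 0$, and $abq^k\neq 1$ for every integer $k$ with $2\le k\le 4N-3$. Then the $q$-Catalan–Hankel Pfaffian of the big $q$-Jacobi moment sums is $$\mathrm{Pf}\left(([j]_q-[i]_q)\sum_{m=0}^{i+j-1}(-1)^m\left[{i+j-1\atop m}\right]_q q^{-(i+j-1)(m+1)+\binom{m+1}{2}}\frac{(aq,cq;q)_m}{(abq^2;q)_m}\right)_{i,j=0}^{2N-1}$$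 $$=(ac)^{N(N-1)}\,q^{\frac16N(N-1)(4N-5)}\prod_{k=0}^{N-1}\frac{(q;q)_{2k+1}\,(aq,bq,cq,abc^{-1}q;q)_{2k}}{(1-q)\,(abq^2;q)_{2(k+N)-2}},$$ where the diagonal entries of the matrix are $0$. -/

import Mathlib

/-- The finite `q`-shifted factorial `(x;q)_n = ∏_{i=0}^{n-1} (1 - x q^i)`. -/
def qPoch (x q : ℂ) (n : ℕ) : ℂ :=
  ∏ i ∈ Finset.range n, (1 - x * q ^ i)

/-- The `q`-number `[n]_q = (1 - q^n) / (1 - q)`. -/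
noncomputable def qNum (q : ℂ) (n : ℕ) : ℂ :=
  (1 - q ^ n) / (1 - q)

/-- The `q`-binomial coefficient `(q;q)_n / ((q;q)_m (q;q)_{n-m})`, used for `m ≤ n`. -/
noncomputable def qBinom (q : ℂ) (n m : ℕ) : ℂ :=
  qPoch q q n / (qPoch q q m * qPoch q q (n - m))

/-- The Pfaffian of a skew-symmetric matrix `A = (a_{i,j})_{i,j=0}^{2N-1}`:
`Pf A = (1 / (2^N N!)) ∑_{σ} sgn(σ) ∏_{i=0}^{N-1} a_{σ(2i), σ(2i+1)}`,
the sum being over all permutations `σ` of `{0, …, 2N-1}`. -/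
noncomputable def pfaffian {N : ℕ} (A : Matrix (Fin (2 * N)) (Fin (2 * N)) ℂ) : ℂ :=
  (1 / ((2 : ℂ) ^ N * (N.factorial : ℂ))) *
    ∑ σ : Equiv.Perm (Fin (2 * N)), ((Equiv.Perm.sign σ : ℤ) : ℂ) *
      ∏ i : Fin N, A (σ ⟨2 * i.1, by omega⟩) (σ ⟨2 * i.1 + 1, by omega⟩)

/-- The big `q`-Jacobi moment sum
`∑_{m=0}^{n} (-1)^m [n choose m]_q q^{-n(m+1) + binom(m+1,2)} (aq,cq;q)_m / (abq²;q)_m`. -/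
noncomputable def bigQJacobiSum (a b c q : ℂ) (n : ℕ) : ℂ :=
  ∑ m ∈ Finset.range (n + 1),
    (-1) ^ m * qBinom q n m
      * q ^ (-((n : ℤ) * ((m : ℤ) + 1)) + ((Nat.choose (m + 1) 2 : ℕ) : ℤ))
      * (qPoch (a * q) q m * qPoch (c * q) q m / qPoch (a * b * q ^ 2) q m)

/-- The matrix `(([j]_q - [i]_q) S_{i+j-1})_{i,j=0}^{2N-1}`, where `S_n` is the big `q`-Jacobi
moment sum. The truncated subtraction matters only at `i = j = 0`, where the entry is `0`. -/
noncomputable def bigQJacobiMatrix (a b c q : ℂ) (N : ℕ) :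
    Matrix (Fin (2 * N)) (Fin (2 * N)) ℂ :=
  Matrix.of fun i j =>
    (qNum q j.1 - qNum q i.1) * bigQJacobiSum a b c q (i.1 + j.1 - 1)

/-! Let `L` be the functional with `L((qX;q)_n) = (aq,cq;q)_n / (abq²;q)_n`. Expanding `X^n` in the
basis `(qX;q)_m` shows that the moment sums are the values `L(X^n)`. The matrix is then the Gram
matrix of the monomials for the skew form `⟨f,g⟩ = L((f(qx)g(x) - f(x)g(qx)) / ((1-q)x))`. A
unitriangular change of basis preserves the Pfaffian, and a tridiagonal skew matrix has as Pfaffian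
the product of its entries `(2k, 2k+1)`. So it suffices to find monic `P_n` with `⟨P_n,P_m⟩ = 0` for
`|n-m| ≥ 2` and to compute `⟨P_{2k},P_{2k+1}⟩`.

Big `q`-Jacobi polynomials with shifted parameters do this. The form has a closed value on the pair
`(X;q)_k`, `(bX/c;q)_m` (`skewForm_qPochPoly`). Paired with `(bX/c;q)_m`, `P_n` therefore gives a
barycentric sum over the nodes `q^k`, `k ≤ n`. For `m ≤ n-2` the summand is a polynomial in `q^k` of
degree below `n`, so the sum vanishes; for `m = n-1` one linear denominator survives and Lagrange
interpolation at its root gives the norm.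

Divisions along the way require generic parameters. Both sides are continuous along `(a+t, b+t,
c+t)` at `t = 0`, and only countably many `t` are not generic, so the identity extends to the stated
range. -/

open Polynomial

/-! ### Pfaffians: congruence and tridiagonal matrices -/

/-- The unnormalised Pfaffian sum over permutations of `κ × Bool`. -/
def pfaffianSum {κ : Type*} [Fintype κ] [DecidableEq κ]
    (M : Matrix (κ × Bool) (κ × Bool) ℂ) : ℂ :=
  ∑ σ : Equiv.Perm (κ × Bool), ((Equiv.Perm.sign σ : ℤ) : ℂ) *
    ∏ i : κ, M (σ (i, false)) (σ (i, true))

lemma det_submatrix_eq_zero_of_not_bijective {n : Type*} [Fintype n] [DecidableEq n]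
    (T : Matrix n n ℂ) (p : n → n) (hp : ¬ Function.Bijective p) :
    (T.submatrix id p).det = 0 := by
  rw [← Finite.injective_iff_bijective, Function.Injective] at hp
  push Not at hp
  obtain ⟨i, j, hij, hne⟩ := hp
  exact Matrix.det_zero_of_column_eq hne (fun k => by simp [hij])

/-- Expanding every entry and summing over `σ` first leaves, for each choice `p` of column indices,
the determinant of `T` with columns selected by `p`. It vanishes unless `p` is a permutation, and
then equals `sign p * det T`. -/
lemma pfaffianSum_congruence {κ : Type*} [Fintype κ] [DecidableEq κ]
    (T M : Matrix (κ × Bool) (κ × Bool) ℂ) :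
    pfaffianSum (T * M * T.transpose) = T.det * pfaffianSum M := by
  have hentry : ∀ x y, (T * M * T.transpose) x y =
      ∑ p : Bool → κ × Bool, (T x (p false) * T y (p true)) * M (p false) (p true) := by
    intro x y
    rw [← (Equiv.boolArrowEquivProd (κ × Bool)).symm.sum_comp, Fintype.sum_prod_type_right]
    simp only [Matrix.mul_apply, Matrix.transpose_apply, Finset.sum_mul]
    refine Finset.sum_congr rfl fun l _ => Finset.sum_congr rfl fun k _ => ?_
    simp [Equiv.boolArrowEquivProd]
    ring
  calc pfaffianSum (T * M * T.transpose)
      = ∑ f : κ → Bool → κ × Bool, (∏ i, M (f i false) (f i true)) *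
          (T.submatrix id (Function.uncurry f)).det := by
        unfold pfaffianSum
        simp only [hentry, Finset.prod_univ_sum, Fintype.piFinset_univ, Finset.mul_sum]
        rw [Finset.sum_comm]
        refine Finset.sum_congr rfl fun f _ => ?_
        rw [Matrix.det_apply', Finset.mul_sum]
        refine Finset.sum_congr rfl fun σ _ => ?_
        rw [Finset.prod_mul_distrib, Fintype.prod_prod_type]
        simp only [Fintype.prod_bool, Matrix.submatrix_apply, id, Function.uncurry_apply_pair]
        rw [Finset.prod_mul_distrib, Finset.prod_mul_distrib]
        ring
    _ = ∑ p : κ × Bool → κ × Bool, (∏ i, M (p (i, false)) (p (i, true))) *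
          (T.submatrix id p).det := by
        rw [← (Equiv.curry κ Bool (κ × Bool)).sum_comp]
        rfl
    _ = ∑ p : κ × Bool → κ × Bool with Function.Bijective p,
          (∏ i, M (p (i, false)) (p (i, true))) * (T.submatrix id p).det := by
        refine (Finset.sum_subset (Finset.filter_subset _ _) fun f _ hbij => ?_).symm
        rw [det_submatrix_eq_zero_of_not_bijective _ _ (by simpa using hbij), mul_zero]
    _ = ∑ τ : Equiv.Perm (κ × Bool), (∏ i, M (τ (i, false)) (τ (i, true))) *
          (T.submatrix id τ).det :=
        Finset.sum_bij (fun p h => Equiv.ofBijective p (Finset.mem_filter.1 h).2)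
          (fun _ _ => Finset.mem_univ _) (fun _ _ _ _ h => by injection h)
          (fun b _ => ⟨b, Finset.mem_filter.2 ⟨Finset.mem_univ _, b.bijective⟩,
            Equiv.coe_fn_injective rfl⟩) fun _ _ => rfl
    _ = T.det * pfaffianSum M := by
        unfold pfaffianSum
        rw [Finset.mul_sum]
        refine Finset.sum_congr rfl fun τ _ => ?_
        rw [Matrix.det_permute']
        ring

/-- The permutation of `κ × Bool` permuting the blocks by `π` and then flipping the blocks
selected by `ε`. -/
def blockPerm {κ : Type*} (p : Equiv.Perm κ × (κ → Equiv.Perm Bool)) :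
    Equiv.Perm (κ × Bool) :=
  (Equiv.prodCongrRight p.2).trans (Equiv.prodCongrLeft fun _ => p.1)

lemma blockPerm_apply {κ : Type*} (p : Equiv.Perm κ × (κ → Equiv.Perm Bool)) (i : κ) (b : Bool) :
    blockPerm p (i, b) = (p.1 i, p.2 i b) := rfl

lemma blockPerm_injective {κ : Type*} : Function.Injective (blockPerm (κ := κ)) := by
  rintro ⟨π, ε⟩ ⟨π', ε'⟩ h
  have h' : ∀ i b, (π i, ε i b) = (π' i, ε' i b) := fun i b => by
    simpa only [blockPerm_apply] using congrArg (fun σ => σ (i, b)) h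
  refine Prod.ext (Equiv.ext fun i => (Prod.ext_iff.1 (h' i true)).1) ?_
  exact funext fun i => Equiv.ext fun b => (Prod.ext_iff.1 (h' i b)).2

/-- The permutation of the blocks acts identically on both copies of `κ`, so its sign enters
squared. -/
lemma sign_blockPerm {κ : Type*} [Fintype κ] [DecidableEq κ]
    (p : Equiv.Perm κ × (κ → Equiv.Perm Bool)) :
    Equiv.Perm.sign (blockPerm p) = ∏ i, Equiv.Perm.sign (p.2 i) := by
  have : blockPerm p =
      (Equiv.prodCongrLeft fun _ => p.1 : Equiv.Perm (κ × Bool)) *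
        (Equiv.prodCongrRight p.2 : Equiv.Perm (κ × Bool)) := rfl
  rw [this, Equiv.Perm.sign_mul, Equiv.Perm.sign_prodCongrRight, Equiv.Perm.sign_prodCongrLeft]
  simp

lemma exists_blockPerm_eq {κ : Type*} [Finite κ] (σ : Equiv.Perm (κ × Bool))
    (h : ∀ i, (σ (i, true)) = ((σ (i, false)).1, !(σ (i, false)).2)) :
    ∃ p, blockPerm p = σ := by
  have hinj : Function.Injective fun i => (σ (i, false)).1 := by
    intro i j hij
    simp only at hij
    by_cases h2 : (σ (i, false)).2 = (σ (j, false)).2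
    · have := σ.injective (Prod.ext hij h2)
      exact (Prod.ext_iff.1 this).1
    · have : σ (i, false) = σ (j, true) := by
        rw [h j]
        refine Prod.ext hij ?_
        revert h2
        cases (σ (i, false)).2 <;> cases (σ (j, false)).2 <;> simp
      have := σ.injective this
      simp at this
  refine ⟨(Equiv.ofBijective _ (Finite.injective_iff_bijective.1 hinj),
    fun i => if (σ (i, false)).2 then Equiv.swap false true else 1), ?_⟩
  ext1 ⟨i, b⟩
  rw [blockPerm_apply]
  cases b
  · refine Prod.ext rfl ?_
    cases h3 : (σ (i, false)).2 <;> simp [h3]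
  · rw [h i]
    refine Prod.ext rfl ?_
    cases h3 : (σ (i, false)).2 <;> simp [h3]

/-- Only the `2^n n!` block permutations contribute, all equally: each flip changes the sign of `σ`
and, by skew-symmetry, the sign of one entry. -/
lemma pfaffianSum_eq_of_support {κ : Type*} [Fintype κ] [DecidableEq κ]
    (M : Matrix (κ × Bool) (κ × Bool) ℂ) (hskew : ∀ x y, M x y = - M y x)
    (hsupp : ∀ σ : Equiv.Perm (κ × Bool), (∀ i, M (σ (i, false)) (σ (i, true)) ≠ 0) →
      ∀ i, (σ (i, true)) = ((σ (i, false)).1, !(σ (i, false)).2)) :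
    pfaffianSum M = 2 ^ Fintype.card κ * (Fintype.card κ).factorial *
      ∏ i, M (i, false) (i, true) := by
  have hterm : ∀ p : Equiv.Perm κ × (κ → Equiv.Perm Bool),
      ((Equiv.Perm.sign (blockPerm p) : ℤ) : ℂ) *
        ∏ i : κ, M (blockPerm p (i, false)) (blockPerm p (i, true)) =
      ∏ i, M (i, false) (i, true) := by
    intro p
    rw [sign_blockPerm]
    simp only [blockPerm_apply]
    push_cast
    rw [← Finset.prod_mul_distrib, ← Equiv.prod_comp p.1 (fun i => M (i, false) (i, true))]
    refine Finset.prod_congr rfl fun i _ => ?_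
    have hb : ∀ e : Equiv.Perm Bool, e = 1 ∨ e = Equiv.swap false true := by decide
    rcases hb (p.2 i) with h | h
    · simp [h]
    · rw [h, Equiv.Perm.sign_swap (by simp), Equiv.swap_apply_left, Equiv.swap_apply_right,
        hskew (p.1 i, true)]
      simp
  unfold pfaffianSum
  rw [← Finset.sum_of_injOn (s := Finset.univ) blockPerm blockPerm_injective.injOn (by simp)
    (f := fun _ => ∏ i, M (i, false) (i, true)) ?_ (fun p _ => (hterm p).symm)]
  · rw [Finset.sum_const, Finset.card_univ, Fintype.card_prod, Fintype.card_perm, Fintype.card_fun,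
      Fintype.card_perm, Fintype.card_bool, nsmul_eq_mul]
    push_cast
    simp only [Nat.factorial_two, Nat.cast_ofNat]
    ring
  · intro σ _ hσ
    by_contra hne
    apply hσ
    obtain ⟨p, hp⟩ := exists_blockPerm_eq σ (hsupp σ fun i h0 => hne (by
      rw [Finset.prod_eq_zero (Finset.mem_univ i) h0, mul_zero]))
    exact ⟨p, by simp, hp⟩

/-- The identification of `Fin N × Bool` with `Fin (2 * N)` sending `(i, false)` to `2 * i` and
`(i, true)` to `2 * i + 1`. -/
def pairEquiv (N : ℕ) : Fin N × Bool ≃ Fin (2 * N) where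
  toFun x := ⟨2 * x.1.1 + x.2.toNat, by have := x.1.2; have := x.2.toNat_le; omega⟩
  invFun j := (⟨j.1 / 2, by omega⟩, j.1 % 2 == 1)
  left_inv := by
    rintro ⟨i, b⟩
    cases b <;> (simp [Fin.ext_iff]; try omega)
  right_inv := by
    intro j
    rcases Nat.mod_two_eq_zero_or_one j.1 with h | h <;> simp [Fin.ext_iff, h] <;> omega

lemma pfaffian_eq_pfaffianSum {N : ℕ} (A : Matrix (Fin (2 * N)) (Fin (2 * N)) ℂ) :
    pfaffian A = (1 / ((2 : ℂ) ^ N * (N.factorial : ℂ))) *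
      pfaffianSum (A.submatrix (pairEquiv N) (pairEquiv N)) := by
  unfold pfaffian pfaffianSum
  congr 1
  rw [← (pairEquiv N).permCongr.sum_comp]
  refine Finset.sum_congr rfl fun σ _ => ?_
  rw [Equiv.Perm.sign_permCongr]
  congr 1
  refine Finset.prod_congr rfl fun i _ => ?_
  have h0 : (⟨2 * i.1, by omega⟩ : Fin (2 * N)) = pairEquiv N (i, false) := rfl
  have h1 : (⟨2 * i.1 + 1, by omega⟩ : Fin (2 * N)) = pairEquiv N (i, true) := rfl
  rw [h0, h1]
  simp [Equiv.permCongr_apply]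

theorem pfaffian_congruence {N : ℕ} (T A : Matrix (Fin (2 * N)) (Fin (2 * N)) ℂ) :
    pfaffian (T * A * T.transpose) = T.det * pfaffian A := by
  rw [pfaffian_eq_pfaffianSum, pfaffian_eq_pfaffianSum,
    ← Matrix.submatrix_mul_equiv _ _ _ (pairEquiv N),
    ← Matrix.submatrix_mul_equiv _ _ _ (pairEquiv N),
    ← Matrix.transpose_submatrix, pfaffianSum_congruence, Matrix.det_submatrix_equiv_self]
  ring

/-- An involution of `{0, …, 2N-1}` moving every point to a neighbour
exchanges `2k` and `2k+1`. -/
lemma adjacent_involution {N : ℕ} (p : ℕ → ℕ) (hinv : ∀ x < 2 * N, p (p x) = x)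
    (hadj : ∀ x < 2 * N, p x = x + 1 ∨ x = p x + 1) (k : ℕ)
    (hk : k < N) : p (2 * k) = 2 * k + 1 := by
  induction k with
  | zero => have := hadj 0 (by omega); simp at this ⊢; omega
  | succ k ih =>
    have h1 := ih (by omega)
    have h2 := hinv (2 * k) (by omega)
    rw [h1] at h2
    rcases hadj (2 * (k + 1)) (by omega) with h | h
    · exact h
    · have h3 := hinv (2 * (k + 1)) (by omega)
      rw [show p (2 * (k + 1)) = 2 * k + 1 by omega, h2] at h3
      omega

theorem pfaffian_tridiagonal {N : ℕ} (A : Matrix (Fin (2 * N)) (Fin (2 * N)) ℂ)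
    (hskew : ∀ i j, A i j = - A j i)
    (htri : ∀ i j : Fin (2 * N), i.1 + 1 ≠ j.1 → j.1 + 1 ≠ i.1 → A i j = 0) :
    pfaffian A = ∏ k : Fin N, A ⟨2 * k.1, by omega⟩ ⟨2 * k.1 + 1, by omega⟩ := by
  rw [pfaffian_eq_pfaffianSum,
    pfaffianSum_eq_of_support (A.submatrix (pairEquiv N) (pairEquiv N)) fun x y => hskew _ _]
  · have h2 : (2 : ℂ) ^ N * (N.factorial : ℂ) ≠ 0 :=
      mul_ne_zero (by simp) (by exact_mod_cast N.factorial_ne_zero)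
    rw [Fintype.card_fin, ← mul_assoc, one_div, inv_mul_cancel₀ h2, one_mul]
    rfl
  · intro σ hσ
    -- Conjugating `flip` by `σ` gives the involution `r` exchanging matched indices. A nonzero term
    -- forces matched indices to be neighbours, so `adjacent_involution` determines `r`.
    let flip : Fin N × Bool → Fin N × Bool := fun x => (x.1, !x.2)
    have hflip : ∀ x, flip (flip x) = x := fun x => by simp [flip]
    let r : Fin (2 * N) → Fin (2 * N) := fun x =>
      pairEquiv N (σ (flip (σ.symm ((pairEquiv N).symm x))))
    have hr : ∀ x, r (r x) = x := fun x => by simp [r, hflip]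
    have hadj0 : ∀ i, (pairEquiv N (σ (i, false))).1 + 1 = (pairEquiv N (σ (i, true))).1 ∨
        (pairEquiv N (σ (i, true))).1 + 1 = (pairEquiv N (σ (i, false))).1 := by
      intro i
      by_contra hcon
      push Not at hcon
      exact hσ i (htri _ _ hcon.1 hcon.2)
    have hadj1 : ∀ x, (r x).1 = x.1 + 1 ∨ x.1 = (r x).1 + 1 := by
      intro x
      obtain ⟨⟨i, b⟩, rfl⟩ : ∃ y, pairEquiv N (σ y) = x :=
        ⟨σ.symm ((pairEquiv N).symm x), by simp⟩
      have := hadj0 i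
      cases b <;> simp [r, flip] <;> omega
    let p : ℕ → ℕ := fun x => if h : x < 2 * N then (r ⟨x, h⟩).1 else 0
    have hp : ∀ x (h : x < 2 * N), p x = (r ⟨x, h⟩).1 := fun x h => by simp [p, h]
    have key := adjacent_involution (N := N) p
      (fun x h => by rw [hp x h, hp _ (r _).2]; simp [hr])
      (fun x h => by rw [hp x h]; exact hadj1 ⟨x, h⟩)
    have key2 : ∀ k : Fin N, r (pairEquiv N (k, false)) = pairEquiv N (k, true) := fun k => by
      have := key k.1 k.2
      rw [hp _ (by omega)] at this
      exact Fin.ext this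
    have key3 : ∀ x, r (pairEquiv N x) = pairEquiv N (flip x) := by
      rintro ⟨k, b⟩
      cases b
      · exact key2 k
      · rw [← key2 k, hr]; rfl
    intro i
    have := key3 (σ (i, false))
    simpa [r, flip] using this

/-! ### `q`-shifted factorials, as numbers and as polynomials -/

lemma qPoch_succ (x q : ℂ) (n : ℕ) : qPoch x q (n + 1) = qPoch x q n * (1 - x * q ^ n) :=
  Finset.prod_range_succ _ _

lemma qPoch_zero (x q : ℂ) : qPoch x q 0 = 1 := rfl

lemma qPoch_add (x q : ℂ) (m n : ℕ) :
    qPoch x q (m + n) = qPoch x q m * qPoch (x * q ^ m) q n := by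
  unfold qPoch
  rw [Finset.prod_range_add]
  simp only [pow_add, mul_assoc]

lemma qPoch_succ' (x q : ℂ) (n : ℕ) : qPoch x q (n + 1) = (1 - x) * qPoch (x * q) q n := by
  rw [add_comm, qPoch_add]
  simp [qPoch]

lemma qPoch_ne_zero {x q : ℂ} {n : ℕ} (h : ∀ k < n, x * q ^ k ≠ 1) : qPoch x q n ≠ 0 :=
  Finset.prod_ne_zero_iff.2 fun k hk => sub_ne_zero.2 (h k (Finset.mem_range.1 hk)).symm

/-- The `q`-shifted factorial `(sX;q)_n` as a polynomial. -/
noncomputable def qPochPoly (s q : ℂ) (n : ℕ) : ℂ[X] :=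
  ∏ i ∈ Finset.range n, (1 - C (s * q ^ i) * X)

lemma qPochPoly_succ (s q : ℂ) (n : ℕ) :
    qPochPoly s q (n + 1) = qPochPoly s q n * (1 - C (s * q ^ n) * X) :=
  Finset.prod_range_succ _ _

lemma qPochPoly_zero (s q : ℂ) : qPochPoly s q 0 = 1 := rfl

lemma qPochPoly_succ' (s q : ℂ) (n : ℕ) :
    qPochPoly s q (n + 1) = (1 - C s * X) * qPochPoly (s * q) q n := by
  unfold qPochPoly
  rw [Finset.prod_range_succ', mul_comm]
  simp [pow_succ', mul_assoc]

lemma qPochPoly_comp (s q t : ℂ) (n : ℕ) :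
    (qPochPoly s q n).comp (C t * X) = qPochPoly (s * t) q n := by
  simp only [qPochPoly, prod_comp, sub_comp, one_comp, mul_comp, C_comp, X_comp]
  refine Finset.prod_congr rfl fun i _ => ?_
  rw [← mul_assoc, ← C_mul]
  ring_nf

lemma natDegree_qPochPoly_factor {u : ℂ} (hu : u ≠ 0) : (1 - C u * X : ℂ[X]).natDegree = 1 := by
  rw [show (1 - C u * X : ℂ[X]) = C (-u) * X + C 1 by simp; ring]
  exact natDegree_linear (neg_ne_zero.2 hu)

lemma leadingCoeff_qPochPoly_factor {u : ℂ} (hu : u ≠ 0) :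
    (1 - C u * X : ℂ[X]).leadingCoeff = -u := by
  rw [show (1 - C u * X : ℂ[X]) = C (-u) * X + C 1 by simp; ring]
  exact leadingCoeff_linear (neg_ne_zero.2 hu)

lemma leadingCoeff_qPochPoly {s q : ℂ} (hs : s ≠ 0) (hq : q ≠ 0) (n : ℕ) :
    (qPochPoly s q n).leadingCoeff = ∏ i ∈ Finset.range n, (-(s * q ^ i)) := by
  rw [qPochPoly, leadingCoeff_prod]
  exact Finset.prod_congr rfl fun i _ =>
    leadingCoeff_qPochPoly_factor (mul_ne_zero hs (pow_ne_zero _ hq))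

lemma qPochPoly_ne_zero {s q : ℂ} (hs : s ≠ 0) (hq : q ≠ 0) (n : ℕ) : qPochPoly s q n ≠ 0 := by
  rw [← leadingCoeff_ne_zero, leadingCoeff_qPochPoly hs hq]
  exact Finset.prod_ne_zero_iff.2 fun i _ => neg_ne_zero.2 (mul_ne_zero hs (pow_ne_zero _ hq))

lemma degree_qPochPoly {s q : ℂ} (hs : s ≠ 0) (hq : q ≠ 0) (n : ℕ) :
    (qPochPoly s q n).degree = n := by
  rw [degree_eq_natDegree (qPochPoly_ne_zero hs hq n), qPochPoly, natDegree_prod _ _ fun i _ => by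
    rw [← leadingCoeff_ne_zero, leadingCoeff_qPochPoly_factor (mul_ne_zero hs (pow_ne_zero _ hq))]
    exact neg_ne_zero.2 (mul_ne_zero hs (pow_ne_zero _ hq))]
  rw [Finset.sum_congr rfl fun i _ => natDegree_qPochPoly_factor (mul_ne_zero hs (pow_ne_zero i hq))]
  simp

/-- A linear functional on polynomials can be prescribed on the basis `(sX;q)_n`. -/
lemma exists_functional {s q : ℂ} (hs : s ≠ 0) (hq : q ≠ 0) (ν : ℕ → ℂ) :
    ∃ L : ℂ[X] →ₗ[ℂ] ℂ, ∀ n, L (qPochPoly s q n) = ν n := by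
  let S : Polynomial.Sequence ℂ := ⟨qPochPoly s q, degree_qPochPoly hs hq⟩
  have hS : ∀ i, IsUnit (S i).leadingCoeff := fun i =>
    isUnit_iff_ne_zero.2 (leadingCoeff_ne_zero.2 (S.ne_zero i))
  refine ⟨(S.basis hS).constr ℂ ν, fun n => ?_⟩
  have : qPochPoly s q n = S.basis hS n := (S.basis_eq_self hS n).symm
  rw [this, Module.Basis.constr_basis]

/-! ### Expansion of powers in the basis `(qX;q)_m` -/

/-- The coefficients of `X ^ n` in the basis `(qX;q)_m`. -/
noncomputable def powCoeff (q : ℂ) (n m : ℕ) : ℂ :=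
  (-1) ^ m * qBinom q n m * q ^ (-((n : ℤ) * ((m : ℤ) + 1)) + ((Nat.choose (m + 1) 2 : ℕ) : ℤ))

lemma qPoch_self_ne_zero {q : ℂ} (hq : ∀ k : ℕ, q ^ (k + 1) ≠ 1) (n : ℕ) : qPoch q q n ≠ 0 :=
  qPoch_ne_zero fun k _ => by rw [← pow_succ']; exact hq k

lemma powCoeff_zero {q : ℂ} (hq0 : q ≠ 0) (hq : ∀ k : ℕ, q ^ (k + 1) ≠ 1) (n : ℕ) :
    powCoeff q (n + 1) 0 = q⁻¹ * powCoeff q n 0 := by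
  have := qPoch_self_ne_zero hq
  simp only [powCoeff, qBinom, qPoch_zero, Nat.sub_zero, one_mul, div_self (this _)]
  rw [← zpow_neg_one, mul_left_comm, ← zpow_add₀ hq0]
  simp [Nat.choose]

lemma powCoeff_last {q : ℂ} (hq0 : q ≠ 0) (hq : ∀ k : ℕ, q ^ (k + 1) ≠ 1) (n : ℕ) :
    powCoeff q (n + 1) (n + 1) = - q ^ (-((n : ℤ) + 1)) * powCoeff q n n := by
  have := qPoch_self_ne_zero hq
  simp only [powCoeff, qBinom, Nat.sub_self, qPoch_zero, mul_one, div_self (this _)]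
  rw [pow_succ (-1 : ℂ), Nat.choose_succ_succ' (n + 1) 1, Nat.choose_one_right]
  have : q ^ (-((n : ℤ) + 1)) * q ^ (-((n : ℤ) * ((n : ℤ) + 1)) + (((n + 1).choose 2 : ℕ) : ℤ)) =
    q ^ (-(((n + 1 : ℕ) : ℤ) * (((n + 1 : ℕ) : ℤ) + 1)) +
      ((n + 1 + (n + 1).choose (1 + 1) : ℕ) : ℤ)) := by
    rw [← zpow_add₀ hq0]
    congr 1
    push_cast
    ring
  rw [← this]
  ring

/-- This is a `q`-Pascal rule. The bound on `m` matters: with truncated subtraction `qBinom q n (n +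
1)` is not zero, so the top coefficient is handled by `powCoeff_last`. -/
lemma powCoeff_succ {q : ℂ} (hq0 : q ≠ 0) (hq : ∀ k : ℕ, q ^ (k + 1) ≠ 1) {n m : ℕ}
    (h : m + 1 ≤ n) :
    powCoeff q (n + 1) (m + 1) =
      q ^ (-((m : ℤ) + 2)) * powCoeff q n (m + 1) - q ^ (-((m : ℤ) + 1)) * powCoeff q n m := by
  obtain ⟨d, rfl⟩ := Nat.exists_eq_add_of_le' h
  have hne := qPoch_self_ne_zero hq
  have h1 : powCoeff q (d + (m + 1)) m = (-1) ^ m * (qPoch q q (d + (m + 1)) /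
      (qPoch q q m * qPoch q q (d + 1))) *
      q ^ (-(((d + (m + 1) : ℕ) : ℤ) * ((m : ℤ) + 1)) + ((Nat.choose (m + 1) 2 : ℕ) : ℤ)) := by
    rw [powCoeff, qBinom, show d + (m + 1) - m = d + 1 by omega]
  have h2 : q ^ (-(((d + (m + 1) : ℕ) : ℤ) * (((m + 1 : ℕ) : ℤ) + 1)) +
      ((Nat.choose (m + 1 + 1) 2 : ℕ) : ℤ)) = q ^ (-(d : ℤ)) *
      q ^ (-(((d + (m + 1) : ℕ) : ℤ) * ((m : ℤ) + 1)) + ((Nat.choose (m + 1) 2 : ℕ) : ℤ)) := by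
    rw [← zpow_add₀ hq0, Nat.choose_succ_succ' (m + 1) 1, Nat.choose_one_right]
    congr 1
    push_cast
    ring
  have h3 : q ^ (-(((d + (m + 1) + 1 : ℕ) : ℤ) * (((m + 1 : ℕ) : ℤ) + 1)) +
      ((Nat.choose (m + 1 + 1) 2 : ℕ) : ℤ)) = q ^ (-(d : ℤ)) * q ^ (-((m : ℤ) + 2)) *
      q ^ (-(((d + (m + 1) : ℕ) : ℤ) * ((m : ℤ) + 1)) + ((Nat.choose (m + 1) 2 : ℕ) : ℤ)) := by
    rw [← zpow_add₀ hq0, ← zpow_add₀ hq0, Nat.choose_succ_succ' (m + 1) 1, Nat.choose_one_right]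
    congr 1
    push_cast
    ring
  rw [h1, powCoeff, powCoeff, qBinom, qBinom, h2, h3,
    show d + (m + 1) + 1 - (m + 1) = d + 1 by omega, show d + (m + 1) - (m + 1) = d by omega]
  generalize q ^ (-(((d + (m + 1) : ℕ) : ℤ) * ((m : ℤ) + 1)) +
    ((Nat.choose (m + 1) 2 : ℕ) : ℤ)) = E
  rw [qPoch_succ q q m, qPoch_succ q q d, qPoch_succ q q (d + (m + 1))]
  have hd := hne d
  have hm := hne m
  have hd1 : 1 - q * q ^ d ≠ 0 := sub_ne_zero.2 (by rw [← pow_succ']; exact (hq d).symm)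
  have hm1 : 1 - q * q ^ m ≠ 0 := sub_ne_zero.2 (by rw [← pow_succ']; exact (hq m).symm)
  have e1 : q ^ (-(d : ℤ)) = (q ^ d)⁻¹ := by simp
  have e2 : q ^ (-((m : ℤ) + 2)) = (q ^ m)⁻¹ * (q⁻¹) ^ 2 := by
    rw [zpow_neg, zpow_add₀ hq0]; simp [mul_comm]
  have e3 : q ^ (-((m : ℤ) + 1)) = (q ^ m)⁻¹ * q⁻¹ := by
    rw [zpow_neg, zpow_add₀ hq0]; simp [mul_comm]
  rw [e1, e2, e3, pow_succ (-1 : ℂ), show q ^ (d + (m + 1)) = q ^ d * q ^ m * q by ring]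
  have hqd := pow_ne_zero d hq0
  have hqm := pow_ne_zero m hq0
  field_simp
  ring

lemma X_mul_qPochPoly {q : ℂ} (hq0 : q ≠ 0) (m : ℕ) :
    X * qPochPoly q q m = C (q ^ (-((m : ℤ) + 1))) * (qPochPoly q q m - qPochPoly q q (m + 1)) := by
  have h : q ^ (-((m : ℤ) + 1)) * (q * q ^ m) = 1 := by
    rw [← pow_succ', ← zpow_natCast q (m + 1), ← zpow_add₀ hq0]
    simp
  rw [qPochPoly_succ, show qPochPoly q q m - qPochPoly q q m * (1 - C (q * q ^ m) * X) =
    C (q * q ^ m) * (X * qPochPoly q q m) by ring, ← mul_assoc, ← C_mul, h, C_1, one_mul]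

theorem X_pow_eq_sum_qPochPoly {q : ℂ} (hq0 : q ≠ 0) (hq : ∀ k : ℕ, q ^ (k + 1) ≠ 1) (n : ℕ) :
    (X ^ n : ℂ[X]) = ∑ m ∈ Finset.range (n + 1), C (powCoeff q n m) * qPochPoly q q m := by
  induction n with
  | zero => simp [powCoeff, qBinom, qPoch_zero, qPochPoly_zero]
  | succ n ih =>
    have step : (X ^ (n + 1) : ℂ[X]) =
        ∑ m ∈ Finset.range (n + 1), C (q ^ (-((m : ℤ) + 1)) * powCoeff q n m) * qPochPoly q q m -
        ∑ m ∈ Finset.range (n + 1),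
          C (q ^ (-((m : ℤ) + 1)) * powCoeff q n m) * qPochPoly q q (m + 1) := by
      rw [pow_succ', ih, Finset.mul_sum, ← Finset.sum_sub_distrib]
      refine Finset.sum_congr rfl fun m _ => ?_
      rw [mul_left_comm, X_mul_qPochPoly hq0, C_mul]
      ring
    have key : ∑ m ∈ Finset.range n, C (powCoeff q (n + 1) (m + 1)) * qPochPoly q q (m + 1) =
        ∑ m ∈ Finset.range n,
          C (q ^ (-(((m + 1 : ℕ) : ℤ) + 1)) * powCoeff q n (m + 1)) * qPochPoly q q (m + 1) -
        ∑ m ∈ Finset.range n,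
          C (q ^ (-((m : ℤ) + 1)) * powCoeff q n m) * qPochPoly q q (m + 1) := by
      rw [← Finset.sum_sub_distrib]
      refine Finset.sum_congr rfl fun m hm => ?_
      rw [powCoeff_succ hq0 hq (Finset.mem_range.1 hm : m < n), C_sub, sub_mul]
      congr 6
    rw [step, Finset.sum_range_succ', Finset.sum_range_succ _ n, Finset.sum_range_succ',
      Finset.sum_range_succ _ n, powCoeff_zero hq0 hq, powCoeff_last hq0 hq, key]
    simp only [neg_mul, C_neg]
    simp
    ring

/-! ### The big `q`-Jacobi functional -/

/-- `L` is the normalised big `q`-Jacobi functional, in the variable `x / q`. -/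
def IsBigQJacobiFunctional (a b c q : ℂ) (L : ℂ[X] →ₗ[ℂ] ℂ) : Prop :=
  ∀ n, L (qPochPoly q q n) =
    qPoch (a * q) q n * qPoch (c * q) q n / qPoch (a * b * q ^ 2) q n

lemma IsBigQJacobiFunctional.map_X_pow {a b c q : ℂ} {L : ℂ[X] →ₗ[ℂ] ℂ}
    (hL : IsBigQJacobiFunctional a b c q L) (hq0 : q ≠ 0) (hq : ∀ k : ℕ, q ^ (k + 1) ≠ 1) (n : ℕ) :
    L (X ^ n) = bigQJacobiSum a b c q n := by
  rw [X_pow_eq_sum_qPochPoly hq0 hq, map_sum]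
  refine Finset.sum_congr rfl fun m _ => ?_
  rw [← smul_eq_C_mul, map_smul, hL, smul_eq_mul]
  rfl

/-- Induction on `m`: the new factor `1 - (b/c) q^(m+1) X` is a combination of `1` and `1 - q^(k+1)
X`, and the latter raises `k` by one. -/
theorem IsBigQJacobiFunctional.map_mul {a b c q : ℂ} {L : ℂ[X] →ₗ[ℂ] ℂ}
    (hL : IsBigQJacobiFunctional a b c q L) (hq0 : q ≠ 0) (hc : c ≠ 0)
    (hab : ∀ k : ℕ, a * b * q ^ k ≠ 1) (k m : ℕ) :
    L (qPochPoly q q k * qPochPoly (b / c * q) q m) =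
      qPoch (a * q) q k * qPoch (c * q) q k * (qPoch (b * q) q m * qPoch (a * b / c * q) q m) /
        qPoch (a * b * q ^ 2) q (k + m) := by
  induction m generalizing k with
  | zero => simp [qPochPoly_zero, qPoch_zero, hL k]
  | succ m ih =>
    have hqk := pow_ne_zero k hq0
    have hqm := pow_ne_zero m hq0
    have hsplit : qPochPoly q q k * qPochPoly (b / c * q) q (m + 1) =
        C (1 - b / c * (q ^ m / q ^ k)) * (qPochPoly q q k * qPochPoly (b / c * q) q m) +
        C (b / c * (q ^ m / q ^ k)) *
          (qPochPoly q q (k + 1) * qPochPoly (b / c * q) q m) := by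
      rw [qPochPoly_succ, qPochPoly_succ, show b / c * q * q ^ m =
        b / c * (q ^ m / q ^ k) * (q * q ^ k) by field_simp, C_mul, C_sub, C_1]
      ring
    have hd : ∀ n, qPoch (a * b * q ^ 2) q n ≠ 0 := fun n =>
      qPoch_ne_zero fun j _ => by rw [mul_assoc, ← pow_add]; exact hab _
    have hd1 : 1 - a * b * q ^ 2 * q ^ (k + m) ≠ 0 :=
      sub_ne_zero.2 (by rw [mul_assoc, ← pow_add]; exact (hab _).symm)
    rw [hsplit, map_add, ← smul_eq_C_mul, ← smul_eq_C_mul, map_smul, map_smul, ih, ih,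
      smul_eq_mul, smul_eq_mul, show k + 1 + m = k + m + 1 by ring,
      show k + (m + 1) = k + m + 1 by ring, qPoch_succ _ _ (k + m), qPoch_succ _ _ k,
      qPoch_succ _ _ k, qPoch_succ _ _ m, qPoch_succ _ _ m]
    have := hd (k + m)
    generalize qPoch (a * b * q ^ 2) q (k + m) = D at *
    rw [pow_add] at *
    generalize q ^ k = x at *
    generalize q ^ m = y at *
    generalize he : 1 - a * b * q ^ 2 * (x * y) = e at *
    field_simp
    rw [← he]
    ring

/-! ### The skew form and its values on shifted factorials -/

/-- The skew form `(f, g) ↦ L ((f(qx) g(x) - f(x) g(qx)) / ((1 - q) x))`. -/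
noncomputable def skewForm (q : ℂ) (L : ℂ[X] →ₗ[ℂ] ℂ) : ℂ[X] →ₗ[ℂ] ℂ[X] →ₗ[ℂ] ℂ :=
  LinearMap.mk₂ ℂ
    -- The constant term is `f(0)g(0) - f(0)g(0) = 0`, so `divX` is exact division by `X`.
    (fun f g => L (divX (f.comp (C q * X) * g - f * g.comp (C q * X))) / (1 - q))
    (fun f f' g => by
      rw [← add_div, ← map_add, ← divX_add, add_comp]; ring_nf)
    (fun r f g => by
      rw [smul_eq_C_mul, mul_comp, C_comp, smul_eq_mul, ← mul_div_assoc, ← smul_eq_mul r,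
        ← map_smul, smul_eq_C_mul, ← divX_C_mul]; ring_nf)
    (fun f g g' => by
      rw [← add_div, ← map_add, ← divX_add, add_comp]; ring_nf)
    (fun r f g => by
      rw [smul_eq_C_mul, mul_comp, C_comp, smul_eq_mul, ← mul_div_assoc, ← smul_eq_mul r,
        ← map_smul, smul_eq_C_mul, ← divX_C_mul]; ring_nf)

lemma skewForm_apply (q : ℂ) (L : ℂ[X] →ₗ[ℂ] ℂ) (f g : ℂ[X]) : skewForm q L f g =
    L (divX (f.comp (C q * X) * g - f * g.comp (C q * X))) / (1 - q) := rfl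

lemma skewForm_skew (q : ℂ) (L : ℂ[X] →ₗ[ℂ] ℂ) (f g : ℂ[X]) :
    skewForm q L f g = - skewForm q L g f := by
  rw [skewForm_apply, skewForm_apply, ← neg_div, ← map_neg, ← neg_one_smul ℂ, smul_eq_C_mul,
    ← divX_C_mul]
  simp only [C_neg, C_1]
  ring_nf

lemma skewForm_of_eq (q : ℂ) (L : ℂ[X] →ₗ[ℂ] ℂ) {f g h : ℂ[X]}
    (hfg : f.comp (C q * X) * g - f * g.comp (C q * X) = X * h) :
    skewForm q L f g = L h / (1 - q) := by
  rw [skewForm_apply, hfg]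
  congr 2
  ext n
  rw [coeff_divX, coeff_X_mul]

lemma skewForm_X_pow (q : ℂ) (L : ℂ[X] →ₗ[ℂ] ℂ) (i j : ℕ) :
    skewForm q L (X ^ i) (X ^ j) = (qNum q j - qNum q i) * L (X ^ (i + j - 1)) := by
  rcases Nat.eq_zero_or_pos (i + j) with h | h
  · obtain ⟨rfl, rfl⟩ : i = 0 ∧ j = 0 := by omega
    rw [skewForm_of_eq q L (h := 0) (by simp)]
    simp
  · rw [skewForm_of_eq q L (h := C (q ^ i - q ^ j) * X ^ (i + j - 1)), ← smul_eq_C_mul, map_smul,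
      smul_eq_mul]
    · simp only [qNum]
      ring
    · rw [mul_left_comm, ← pow_succ', Nat.sub_add_cancel h]
      simp only [pow_comp, X_comp, mul_pow, ← C_pow, C_sub]
      ring

/-- The polynomial factor in the values of the skew form on `q`-shifted factorials. -/
noncomputable def skewFactor (a b c x y : ℂ) : ℂ :=
  (1 - a * b * x * y) * ((1 - x) - b / c * (1 - y)) +
    b / c * (x - y) * (a + c - a * c * x - a * b * y)

/-- For positive `k`, `m` the numerator has the common factor `(qX;q)_{k-1} (bqX/c;q)_{m-1}`, and
the cofactor is `X` times a linear polynomial; `map_mul` evaluates both terms. The prefactor on the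
left turns `(aq;q)_{k-1}` and its analogues into `(a;q)_k`, so that the cases `k = 0` and `m = 0`
obey the same formula. -/
theorem skewForm_qPochPoly {a b c q : ℂ} {L : ℂ[X] →ₗ[ℂ] ℂ}
    (hL : IsBigQJacobiFunctional a b c q L) (hq0 : q ≠ 0) (hq1 : q ≠ 1) (hc : c ≠ 0)
    (hab : ∀ k : ℕ, a * b * q ^ k ≠ 1) (k m : ℕ) :
    (1 - q) * ((1 - a) * (1 - c) * ((1 - b) * (1 - a * b / c))) *
        skewForm q L (qPochPoly 1 q k) (qPochPoly (b / c) q m) =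
      (1 - a * b * q) * (qPoch a q k * qPoch c q k * (qPoch b q m * qPoch (a * b / c) q m)) *
        skewFactor a b c (q ^ k) (q ^ m) / qPoch (a * b * q) q (k + m) := by
  have hq1' : 1 - q ≠ 0 := sub_ne_zero.2 hq1.symm
  have hd : ∀ n, qPoch (a * b * q ^ 2) q n ≠ 0 := fun n =>
    qPoch_ne_zero fun j _ => by rw [mul_assoc, ← pow_add]; exact hab _
  have hd1 : 1 - a * b * q ≠ 0 := sub_ne_zero.2 (by simpa using (hab 1).symm)
  have hcomp : ∀ s n, (qPochPoly s q n).comp (C q * X) = qPochPoly (s * q) q n := fun s n =>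
    qPochPoly_comp s q q n
  have hden : ∀ n, qPoch (a * b * q) q (n + 1) = (1 - a * b * q) * qPoch (a * b * q ^ 2) q n :=
    fun n => by rw [qPoch_succ', mul_assoc (a * b) q q, ← sq]
  have hM := hL.map_mul hq0 hc hab
  rcases k with _ | k <;> rcases m with _ | m
  · rw [skewForm_of_eq q L (h := 0) (by simp [qPochPoly_zero])]
    simp [skewFactor]
  · rw [skewForm_of_eq q L (h := C (-(b / c * (1 - q ^ (m + 1)))) *
      (qPochPoly q q 0 * qPochPoly (b / c * q) q m))]
    · rw [← smul_eq_C_mul, map_smul, smul_eq_mul, hM, zero_add, zero_add, hden, qPoch_succ',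
        qPoch_succ' (a * b / c)]
      have := hd m
      simp only [qPoch_zero, pow_zero, skewFactor]
      generalize qPoch (a * b * q ^ 2) q m = D at *
      generalize 1 - a * b * q = e at *
      field_simp
      ring
    · rw [hcomp, hcomp, qPochPoly_succ (b / c * q), qPochPoly_succ' (b / c)]
      simp only [qPochPoly_zero, C_neg, C_mul, C_sub, C_1, C_pow]
      ring
  · rw [skewForm_of_eq q L (h := C (1 - q ^ (k + 1)) *
      (qPochPoly q q k * qPochPoly (b / c * q) q 0))]
    · rw [← smul_eq_C_mul, map_smul, smul_eq_mul, hM, add_zero, add_zero, hden, qPoch_succ',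
        qPoch_succ' c]
      have := hd k
      simp only [qPoch_zero, pow_zero, skewFactor]
      generalize qPoch (a * b * q ^ 2) q k = D at *
      generalize 1 - a * b * q = e at *
      field_simp
      ring
    · rw [hcomp, hcomp, qPochPoly_succ (1 * q), qPochPoly_succ' 1]
      simp only [qPochPoly_zero, C_mul, C_sub, C_1, C_pow, one_mul]
      ring
  -- The extra `X` is absorbed by writing `q^(k+1) X = 1 - (1 - q^(k+1) X)`.
  · have hsplit : L (qPochPoly q q k * qPochPoly (b / c * q) q m * X) =
        (q ^ (k + 1))⁻¹ * (L (qPochPoly q q k * qPochPoly (b / c * q) q m) -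
          L (qPochPoly q q (k + 1) * qPochPoly (b / c * q) q m)) := by
      rw [← map_sub, eq_inv_mul_iff_mul_eq₀ (pow_ne_zero _ hq0), ← smul_eq_mul, ← map_smul,
        smul_eq_C_mul, qPochPoly_succ]
      congr 1
      rw [← pow_succ']
      ring
    rw [skewForm_of_eq q L
      (h := C ((1 - q ^ (k + 1)) - b / c * (1 - q ^ (m + 1))) *
          (qPochPoly q q k * qPochPoly (b / c * q) q m) +
        C (b / c * (q ^ (k + 1) - q ^ (m + 1))) *
          (qPochPoly q q k * qPochPoly (b / c * q) q m * X))]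
    · have hd2 : 1 - a * b * q ^ 2 * q ^ (k + m) ≠ 0 :=
        sub_ne_zero.2 (by rw [mul_assoc, ← pow_add]; exact (hab _).symm)
      rw [map_add, ← smul_eq_C_mul, ← smul_eq_C_mul, map_smul, map_smul, hsplit, hM, hM,
        smul_eq_mul, smul_eq_mul, show k + 1 + (m + 1) = k + m + 1 + 1 by ring, hden,
        show k + 1 + m = k + m + 1 by ring, qPoch_succ (a * b * q ^ 2),
        qPoch_succ (a * q), qPoch_succ (c * q), qPoch_succ' a,
        qPoch_succ' b, qPoch_succ' c, qPoch_succ' (a * b / c)]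
      have hD := hd (k + m)
      have hx := pow_ne_zero k hq0
      clear hsplit hM hcomp hden hd hL
      rw [skewFactor, pow_succ q k, pow_succ q m]
      rw [pow_add] at hd2 ⊢
      generalize qPoch (a * b * q ^ 2) q (k + m) = D at *
      generalize q ^ k = x at *
      generalize q ^ m = y at *
      generalize 1 - a * b * q = e1 at *
      generalize he : 1 - a * b * q ^ 2 * (x * y) = e at *
      generalize qPoch (a * q) q k = p1 at *
      generalize qPoch (c * q) q k = p2 at *
      generalize qPoch (b * q) q m = p3 at *
      generalize qPoch (a * b / c * q) q m = p4 at *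
      field_simp
      rw [← he]
      ring
    · rw [hcomp, hcomp, qPochPoly_succ (1 * q), qPochPoly_succ' 1, qPochPoly_succ (b / c * q),
        qPochPoly_succ' (b / c)]
      simp only [C_mul, C_sub, C_1, C_pow, one_mul]
      ring

/-! ### Functionals on graded bases, and interpolation at powers of `q` -/

lemma linearMap_eq_zero_of_degree_lt {g : ℕ → ℂ[X]} (hg : ∀ n, (g n).degree = n)
    (φ : ℂ[X] →ₗ[ℂ] ℂ) (m : ℕ) (hφ : ∀ j < m, φ (g j) = 0) (p : ℂ[X]) (hp : p.degree < m) :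
    φ p = 0 := by
  induction m generalizing p with
  | zero =>
    have : p = 0 := by simpa [Nat.WithBot.lt_zero_iff] using hp
    rw [this, map_zero]
  | succ m ih =>
    have hlead : (g m).coeff m ≠ 0 := by
      have e : (g m).coeff m = (g m).leadingCoeff := by
        rw [leadingCoeff, natDegree_eq_of_degree_eq_some (hg m)]
      rw [e, leadingCoeff_ne_zero]
      intro h
      simpa [h] using hg m
    have hr : (p - C (p.coeff m / (g m).coeff m) * g m).degree < m := by
      rw [degree_lt_iff_coeff_zero] at hp ⊢
      intro k hk
      rcases hk.eq_or_lt with rfl | hk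
      · rw [coeff_sub, coeff_C_mul, div_mul_cancel₀ _ hlead, sub_self]
      · have hk' : (m : WithBot ℕ) < k := by exact_mod_cast hk
        rw [coeff_sub, coeff_C_mul, hp k hk, coeff_eq_zero_of_degree_lt ((hg m).trans_lt hk'),
          mul_zero, sub_zero]
    have := ih (fun j hj => hφ j (by omega)) _ hr
    rw [map_sub, ← smul_eq_C_mul, map_smul, hφ m (by omega), smul_zero, sub_zero] at this
    exact this

/-- A functional killing all degrees below `m` sees only the coefficient of `X^m`. This moves values
from the test basis `(bX/c;q)_m` to the polynomials `P_m`. -/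
lemma linearMap_mul_leadingCoeff {g : ℕ → ℂ[X]} (hg : ∀ n, (g n).degree = n)
    (φ : ℂ[X] →ₗ[ℂ] ℂ) (m : ℕ) (hφ : ∀ j < m, φ (g j) = 0) (p : ℂ[X]) (hp : p.degree ≤ m) :
    φ p * (g m).leadingCoeff = p.coeff m * φ (g m) := by
  have hlead : (g m).coeff m = (g m).leadingCoeff := by
    rw [leadingCoeff, natDegree_eq_of_degree_eq_some (hg m)]
  have h := linearMap_eq_zero_of_degree_lt hg φ m hφ
    (C (g m).leadingCoeff * p - C (p.coeff m) * g m) (by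
      rw [degree_lt_iff_coeff_zero]
      intro k hk
      rcases hk.eq_or_lt with rfl | hk
      · rw [coeff_sub, coeff_C_mul, coeff_C_mul, hlead]
        ring
      · have hk' : (m : WithBot ℕ) < k := by exact_mod_cast hk
        rw [coeff_sub, coeff_C_mul, coeff_C_mul, coeff_eq_zero_of_degree_lt (hp.trans_lt hk'),
          coeff_eq_zero_of_degree_lt ((hg m).trans_lt hk')]
        simp)
  rw [map_sub, ← smul_eq_C_mul, ← smul_eq_C_mul, map_smul, map_smul, smul_eq_mul, smul_eq_mul,
    sub_eq_zero] at h
  rw [← h, mul_comm]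

/-- The barycentric weights of the nodes `1, q, …, q ^ n`. -/
noncomputable def qWeight (q : ℂ) (n k : ℕ) : ℂ :=
  Lagrange.nodalWeight (Finset.range (n + 1)) (fun k => q ^ k) k

lemma pow_injective_of_pow_ne_one {q : ℂ} (hq0 : q ≠ 0) (hq : ∀ k : ℕ, q ^ (k + 1) ≠ 1) :
    Function.Injective fun k : ℕ => q ^ k := by
  intro i j hij
  wlog h : i < j generalizing i j
  · rcases (not_lt.1 h).eq_or_lt with h | h
    · exact h.symm
    · exact (this hij.symm h).symm
  obtain ⟨d, rfl⟩ := Nat.exists_eq_add_of_lt h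
  simp only at hij
  rw [add_assoc, pow_add, left_eq_mul₀ (pow_ne_zero _ hq0)] at hij
  exact absurd hij (hq d)

/-- The sum is the coefficient of `X^n` in the interpolant of `p` at `n + 1` nodes, which is `p`
itself. -/
lemma sum_qWeight_mul_eval {q : ℂ} (hq0 : q ≠ 0) (hq : ∀ k : ℕ, q ^ (k + 1) ≠ 1) {n : ℕ}
    {p : ℂ[X]} (hp : p.degree < n) :
    ∑ k ∈ Finset.range (n + 1), qWeight q n k * p.eval (q ^ k) = 0 := by
  have h := Lagrange.coeff_eq_sum (s := Finset.range (n + 1)) (v := fun k : ℕ => q ^ k)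
    (pow_injective_of_pow_ne_one hq0 hq).injOn (P := p) (by
      rw [Finset.card_range]
      exact hp.trans (by exact_mod_cast n.lt_succ_self))
  rw [Finset.card_range, Nat.add_sub_cancel, coeff_eq_zero_of_degree_lt hp] at h
  rw [h]
  refine Finset.sum_congr rfl fun k _ => ?_
  rw [qWeight, Lagrange.nodalWeight, Finset.prod_inv_distrib]
  ring

/-- Barycentric form of the interpolant, evaluated at the root `x⁻¹` of `1 - x X`. -/
lemma sum_qWeight_mul_eval_div {q : ℂ} (hq0 : q ≠ 0) (hq : ∀ k : ℕ, q ^ (k + 1) ≠ 1) {n : ℕ}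
    {p : ℂ[X]} (hp : p.degree < (n + 1 : ℕ)) {x : ℂ} (hx : x ≠ 0) (hxq : ∀ k : ℕ, x * q ^ k ≠ 1) :
    ∑ k ∈ Finset.range (n + 1), qWeight q n k * p.eval (q ^ k) / (1 - x * q ^ k) =
      p.eval x⁻¹ * x ^ n / qPoch x q (n + 1) := by
  have hne : ∀ k : ℕ, x⁻¹ ≠ q ^ k := fun k h => hxq k (by rw [← h, mul_inv_cancel₀ hx])
  have h := Lagrange.eval_interpolate_not_at_node (s := Finset.range (n + 1))
    (v := fun k : ℕ => q ^ k) (x := x⁻¹) (fun k => p.eval (q ^ k)) (fun k _ => hne k)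
  rw [← Lagrange.eq_interpolate (f := p) (pow_injective_of_pow_ne_one hq0 hq).injOn
    (by rwa [Finset.card_range]), Lagrange.eval_nodal] at h
  have hsub : ∀ k : ℕ, x⁻¹ - q ^ k = x⁻¹ * (1 - x * q ^ k) := fun k => by field_simp
  have hprod : ∏ k ∈ Finset.range (n + 1), (x⁻¹ - q ^ k) =
      (x ^ (n + 1))⁻¹ * qPoch x q (n + 1) := by
    simp only [hsub, Finset.prod_mul_distrib, Finset.prod_const, Finset.card_range, qPoch, inv_pow]
  have hsum : ∑ k ∈ Finset.range (n + 1), qWeight q n k * p.eval (q ^ k) / (1 - x * q ^ k) =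
      x⁻¹ * ∑ k ∈ Finset.range (n + 1), Lagrange.nodalWeight (Finset.range (n + 1))
        (fun k : ℕ => q ^ k) k * (x⁻¹ - q ^ k)⁻¹ * p.eval (q ^ k) := by
    rw [Finset.mul_sum]
    refine Finset.sum_congr rfl fun k _ => ?_
    have := sub_ne_zero.2 (hxq k).symm
    rw [hsub, mul_inv, inv_inv, qWeight]
    field_simp
  have hpoch := qPoch_ne_zero (n := n + 1) fun k _ => hxq k
  rw [hsum, h, hprod]
  generalize ∑ k ∈ Finset.range (n + 1), Lagrange.nodalWeight (Finset.range (n + 1))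
        (fun k : ℕ => q ^ k) k * (x⁻¹ - q ^ k)⁻¹ * p.eval (q ^ k) = S
  field_simp
  ring

lemma qWeight_self_mul {q : ℂ} (hq0 : q ≠ 0) (hq : ∀ k : ℕ, q ^ (k + 1) ≠ 1) (n : ℕ) :
    qWeight q n n * qPoch q q n * (qPochPoly 1 q n).leadingCoeff = 1 := by
  have hprod : ∏ j ∈ Finset.range n, (q ^ n - q ^ j) =
      qPoch q q n * (qPochPoly 1 q n).leadingCoeff := by
    rw [leadingCoeff_qPochPoly one_ne_zero hq0, qPoch,
      ← Finset.prod_range_reflect (fun i => 1 - q * q ^ i),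
      ← Finset.prod_mul_distrib]
    refine Finset.prod_congr rfl fun j hj => ?_
    obtain ⟨d, rfl⟩ := Nat.exists_eq_add_of_lt (Finset.mem_range.1 hj)
    rw [show j + d + 1 - 1 - j = d by omega]
    ring
  rw [qWeight, Lagrange.nodalWeight, Finset.prod_inv_distrib, mul_assoc, Finset.range_add_one,
    Finset.erase_insert (by simp), hprod]
  exact inv_mul_cancel₀ (mul_ne_zero (qPoch_self_ne_zero hq n)
    (leadingCoeff_ne_zero.2 (qPochPoly_ne_zero one_ne_zero hq0 n)))

/-! ### Skew-orthogonal polynomials for generic parameters -/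

/-- Parameters for which all the intermediate expressions are defined. -/
structure GenericParams (a b c q : ℂ) : Prop where
  q_ne_zero : q ≠ 0
  q_pow_ne_one : ∀ k : ℕ, q ^ (k + 1) ≠ 1
  a_ne_zero : a ≠ 0
  b_ne_zero : b ≠ 0
  c_ne_zero : c ≠ 0
  a_mul_ne_one : ∀ k : ℕ, a * q ^ k ≠ 1
  c_mul_ne_one : ∀ k : ℕ, c * q ^ k ≠ 1
  b_ne_one : b ≠ 1
  ab_ne_c : a * b ≠ c
  ab_mul_ne_one : ∀ k : ℕ, a * b * q ^ k ≠ 1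

/-- The monic polynomials of degree `n` (monic big `q`-Jacobi polynomials with parameters
`a / q, b / q, c / q`) for which the skew form is tridiagonal. -/
noncomputable def skewPoly (a b c q : ℂ) (n : ℕ) : ℂ[X] :=
  C (qPoch q q n * qPoch a q n * qPoch c q n / qPoch (a * b * q ^ n / q) q n) *
    ∑ k ∈ Finset.range (n + 1),
      C (qWeight q n k * qPoch (a * b * q ^ n / q) q k / (qPoch a q k * qPoch c q k)) *
        qPochPoly 1 q k

namespace GenericParams

variable {a b c q : ℂ}

lemma q_ne_one (h : GenericParams a b c q) : q ≠ 1 := by simpa using h.q_pow_ne_one 0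

lemma degree_qPochPoly_one (h : GenericParams a b c q) (n : ℕ) : (qPochPoly 1 q n).degree = n :=
  degree_qPochPoly one_ne_zero h.q_ne_zero n

lemma degree_qPochPoly_div (h : GenericParams a b c q) (n : ℕ) : (qPochPoly (b / c) q n).degree = n :=
  degree_qPochPoly (div_ne_zero h.b_ne_zero h.c_ne_zero) h.q_ne_zero n

lemma qPoch_a_ne_zero (h : GenericParams a b c q) (n : ℕ) : qPoch a q n ≠ 0 :=
  qPoch_ne_zero fun k _ => h.a_mul_ne_one k

lemma qPoch_c_ne_zero (h : GenericParams a b c q) (n : ℕ) : qPoch c q n ≠ 0 :=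
  qPoch_ne_zero fun k _ => h.c_mul_ne_one k

lemma qPoch_ab_ne_zero (h : GenericParams a b c q) (i n : ℕ) : qPoch (a * b * q ^ i) q n ≠ 0 :=
  qPoch_ne_zero fun k _ => by rw [mul_assoc, ← pow_add]; exact h.ab_mul_ne_one _

lemma qPoch_ab_div_ne_zero (h : GenericParams a b c q) (n : ℕ) : qPoch (a * b * q ^ n / q) q n ≠ 0 := by
  rcases n with _ | n
  · simp [qPoch_zero]
  · rw [pow_succ, ← mul_assoc, mul_div_cancel_right₀ _ h.q_ne_zero]
    exact h.qPoch_ab_ne_zero n _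

lemma normalization_ne_zero (h : GenericParams a b c q) :
    (1 - q) * ((1 - a) * (1 - c) * ((1 - b) * (1 - a * b / c))) ≠ 0 := by
  have h1 : (1 - a * b / c) ≠ 0 := sub_ne_zero.2 fun e => h.ab_ne_c (by
    rw [eq_comm, div_eq_one_iff_eq h.c_ne_zero] at e; exact e)
  have h2 : a ≠ 1 := by simpa using h.a_mul_ne_one 0
  have h3 : c ≠ 1 := by simpa using h.c_mul_ne_one 0
  exact mul_ne_zero (sub_ne_zero.2 h.q_ne_one.symm) (mul_ne_zero (mul_ne_zero
    (sub_ne_zero.2 h2.symm) (sub_ne_zero.2 h3.symm))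
    (mul_ne_zero (sub_ne_zero.2 h.b_ne_one.symm) h1))

lemma degree_skewPoly_le (h : GenericParams a b c q) (n : ℕ) : (skewPoly a b c q n).degree ≤ n := by
  rw [degree_le_iff_coeff_zero]
  intro k hk
  rw [skewPoly, coeff_C_mul, finsetSum_coeff, Finset.sum_eq_zero, mul_zero]
  intro j hj
  rw [coeff_C_mul, coeff_eq_zero_of_degree_lt, mul_zero]
  rw [h.degree_qPochPoly_one]
  refine lt_of_le_of_lt ?_ hk
  exact_mod_cast Nat.le_of_lt_succ (Finset.mem_range.1 hj)

lemma coeff_skewPoly_self (h : GenericParams a b c q) (n : ℕ) : (skewPoly a b c q n).coeff n = 1 := by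
  have hlead : (qPochPoly 1 q n).coeff n = (qPochPoly 1 q n).leadingCoeff := by
    rw [leadingCoeff, natDegree_eq_of_degree_eq_some (h.degree_qPochPoly_one n)]
  rw [skewPoly, coeff_C_mul, finsetSum_coeff, Finset.sum_range_succ, Finset.sum_eq_zero,
    zero_add, coeff_C_mul, hlead]
  · have h1 := h.qPoch_a_ne_zero n
    have h2 := h.qPoch_c_ne_zero n
    have h3 := h.qPoch_ab_div_ne_zero n
    have h4 := qWeight_self_mul h.q_ne_zero h.q_pow_ne_one n
    field_simp
    linear_combination h4
  · intro j hj
    rw [coeff_C_mul, coeff_eq_zero_of_degree_lt, mul_zero]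
    rw [h.degree_qPochPoly_one]
    exact_mod_cast Finset.mem_range.1 hj

lemma skewForm_skewPoly (h : GenericParams a b c q) {L : ℂ[X] →ₗ[ℂ] ℂ}
    (hL : IsBigQJacobiFunctional a b c q L) (n m : ℕ) :
    (1 - q) * ((1 - a) * (1 - c) * ((1 - b) * (1 - a * b / c))) *
        skewForm q L (skewPoly a b c q n) (qPochPoly (b / c) q m) =
      qPoch q q n * qPoch a q n * qPoch c q n / qPoch (a * b * q ^ n / q) q n *
        ((1 - a * b * q) * (qPoch b q m * qPoch (a * b / c) q m)) *
        ∑ k ∈ Finset.range (n + 1), qWeight q n k * qPoch (a * b * q ^ n / q) q k *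
          skewFactor a b c (q ^ k) (q ^ m) / qPoch (a * b * q) q (k + m) := by
  rw [skewPoly, ← smul_eq_C_mul, map_smul, LinearMap.smul_apply, smul_eq_mul, map_sum,
    LinearMap.sum_apply, mul_left_comm, mul_assoc (_ / _)]
  congr 1
  rw [Finset.mul_sum, Finset.mul_sum]
  refine Finset.sum_congr rfl fun k _ => ?_
  rw [← smul_eq_C_mul, map_smul, LinearMap.smul_apply, smul_eq_mul, mul_left_comm,
    skewForm_qPochPoly hL h.q_ne_zero h.q_ne_one h.c_ne_zero h.ab_mul_ne_one]
  have h1 := h.qPoch_a_ne_zero k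
  have h2 := h.qPoch_c_ne_zero k
  field_simp

lemma exists_skewFactor_poly (hc : c ≠ 0) (m : ℕ) : ∃ p : ℂ[X],
    (∀ x, p.eval x = skewFactor a b c x (q ^ m)) ∧ p.natDegree ≤ m + 1 := by
  refine ⟨C (-(a * b * (1 - q ^ m))) * X ^ 2 +
    C (-1 - a * b * q ^ m * (1 - b / c * (1 - q ^ m)) + b / c * (a + c - a * b * q ^ m) +
      b / c * q ^ m * (a * c)) * X +
    C (1 - b / c * (1 - q ^ m) - b / c * q ^ m * (a + c - a * b * q ^ m)), fun x => ?_, ?_⟩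
  · simp only [eval_add, eval_mul, eval_C, eval_X, eval_pow, skewFactor]
    field_simp
    ring
  · rcases m with _ | m
    -- For `m = 0` the quadratic coefficient vanishes; without this the degree bound `m + 1` would
    -- fail.
    · simp only [pow_zero, sub_self, mul_zero, neg_zero, C_0, zero_mul, zero_add]
      exact natDegree_linear_le
    · exact natDegree_quadratic_le.trans (by omega)

/-- With `n = m + 2 + d`, the quotient `(abq^(n-1);q)_k / (abq^(m+1);q)_k` equals `(abq^(m+1+k);q)_d
/ (abq^(m+1);q)_d`, of degree `d` in `q^k`. Together with `skewFactor` the degree is at most `m + 1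
+ d < n`. -/
lemma skewForm_skewPoly_eq_zero (h : GenericParams a b c q) {L : ℂ[X] →ₗ[ℂ] ℂ}
    (hL : IsBigQJacobiFunctional a b c q L)
    {n m : ℕ} (hmn : m + 2 ≤ n) :
    skewForm q L (skewPoly a b c q n) (qPochPoly (b / c) q m) = 0 := by
  obtain ⟨p, hp, hpd⟩ := exists_skewFactor_poly (a := a) (b := b) (q := q) h.c_ne_zero m
  obtain ⟨d, rfl⟩ := Nat.exists_eq_add_of_le hmn
  refine (mul_eq_zero.1 ?_).resolve_left h.normalization_ne_zero
  rw [h.skewForm_skewPoly hL, ← mul_zero, ← zero_div (qPoch (a * b * q) q m *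
    qPoch (a * b * q ^ (m + 1)) q d), ← sum_qWeight_mul_eval h.q_ne_zero h.q_pow_ne_one
    (n := m + 2 + d) (p := p * qPochPoly (a * b * q ^ (m + 1)) q d), Finset.sum_div]
  · congr 1
    refine Finset.sum_congr rfl fun k _ => ?_
    have e1 : a * b * q ^ (m + 2 + d) / q = a * b * q ^ (m + 1) * q ^ d := by
      rw [div_eq_iff h.q_ne_zero]; ring
    have e2 : (qPochPoly (a * b * q ^ (m + 1)) q d).eval (q ^ k) =
        qPoch (a * b * q ^ (m + 1) * q ^ k) q d := by
      rw [qPochPoly, eval_prod]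
      refine Finset.prod_congr rfl fun i _ => ?_
      simp only [eval_sub, eval_one, eval_mul, eval_C, eval_X]
      ring
    have e3 : qPoch (a * b * q) q (k + m) =
        qPoch (a * b * q) q m * qPoch (a * b * q ^ (m + 1)) q k := by
      rw [add_comm, qPoch_add, mul_assoc (a * b), ← pow_succ']
    have e4 : qPoch (a * b * q ^ (m + 1)) q d * qPoch (a * b * q ^ (m + 1) * q ^ d) q k =
        qPoch (a * b * q ^ (m + 1)) q k * qPoch (a * b * q ^ (m + 1) * q ^ k) q d := by
      rw [← qPoch_add, ← qPoch_add, add_comm d k]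
    have n1 := h.qPoch_ab_ne_zero (m + 1) d
    have n2 := h.qPoch_ab_ne_zero (m + 1) k
    have n3 := h.qPoch_ab_ne_zero 1 m
    rw [pow_one] at n3
    rw [e1, e3, eval_mul, e2, hp, div_eq_div_iff (mul_ne_zero n3 n2) (mul_ne_zero n3 n1)]
    linear_combination qWeight q (m + 2 + d) k * skewFactor a b c (q ^ k) (q ^ m) *
      qPoch (a * b * q) q m * e4
  · have hd := natDegree_eq_of_degree_eq_some (degree_qPochPoly
      (mul_ne_zero (mul_ne_zero h.a_ne_zero h.b_ne_zero) (pow_ne_zero (m + 1) h.q_ne_zero))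
      h.q_ne_zero d)
    refine lt_of_le_of_lt degree_le_natDegree ?_
    have := natDegree_mul_le (p := p) (q := qPochPoly (a * b * q ^ (m + 1)) q d)
    exact_mod_cast (by omega : _ < m + 2 + d)

/-- At this point `1 - a b x y` vanishes, and the remaining term of `skewFactor` splits into linear
factors. -/
lemma skewFactor_inv (h : GenericParams a b c q) (m : ℕ) : skewFactor a b c (a * b * q ^ m)⁻¹ (q ^ m) =
    -((1 - a * b * q ^ m * q ^ m) * (1 - b * q ^ m) * (1 - a * b / c * q ^ m)) /
      (a * b * q ^ m * q ^ m) := by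
  have h1 := h.a_ne_zero
  have h2 := h.b_ne_zero
  have h3 := h.c_ne_zero
  have h4 := pow_ne_zero m h.q_ne_zero
  rw [skewFactor]
  field_simp
  ring

end GenericParams

/-- The skew norm `⟨P_m, P_{m+1}⟩` up to the sign `(-1)^m`. -/
noncomputable def skewNorm (a b c q : ℂ) (m : ℕ) : ℂ :=
  (a * c) ^ m * (∏ i ∈ Finset.range m, q ^ i) *
    (qPoch q q (m + 1) * (qPoch (a * q) q m * qPoch (b * q) q m * qPoch (c * q) q m *
      qPoch (a * b * c⁻¹ * q) q m)) /
    ((1 - q) * (qPoch (a * b * q ^ 2) q (2 * m) * qPoch (a * b * q ^ m) q m))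

lemma skewNorm_rearrangement {A B E G Q P1 P2 P3 P4 K1 K2 K3 K4 D1 D2 D3 D4 D5 s : ℂ}
    (h3 : D3 ≠ 0) (h4 : D4 ≠ 0) (h5 : D5 ≠ 0) (hE : E ≠ 0)
    (hs : s * s = 1) :
    -(Q * (K1 * P1) * (K2 * P2) / (D2 * D3) * (D5 * (K3 * P3 * (K4 * P4))) *
        (D4 * D3 * (A * B * G ^ 2) / (D4 * (D5 * D1)))) =
      E * (K1 * K2 * (K3 * K4)) *
        (-(s * (A * G * (Q * (P1 * P3 * P2 * P4)) / (E * (D1 * D2)))) * (s * B * G)) := by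
  have e3 := mul_inv_cancel₀ h3
  have e4 := mul_inv_cancel₀ h4
  have e5 := mul_inv_cancel₀ h5
  have eE := mul_inv_cancel₀ hE
  simp only [div_eq_mul_inv, mul_inv]
  generalize D1⁻¹ = d1
  generalize D2⁻¹ = d2
  generalize D3⁻¹ = d3 at *
  generalize D4⁻¹ = d4 at *
  generalize D5⁻¹ = d5 at *
  generalize E⁻¹ = e at *
  trans -(Q * K1 * P1 * K2 * P2 * d2 * K3 * P3 * K4 * P4 * A * B * G ^ 2 * d1)
  · trans -(Q * K1 * P1 * K2 * P2 * d2 * K3 * P3 * K4 * P4 * A * B * G ^ 2 * d1) *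
      ((D3 * d3) * (D4 * d4) * (D5 * d5))
    · ring
    · rw [e3, e4, e5]; ring
  · trans -(Q * K1 * P1 * K2 * P2 * d2 * K3 * P3 * K4 * P4 * A * B * G ^ 2 * d1) *
      ((E * e) * (s * s))
    · rw [eE, hs]; ring
    · ring

namespace GenericParams

variable {a b c q : ℂ}

/-- Here `n = m + 1`, and the quotient of shifted factorials is `(1 - abq^m) / (1 - abq^m q^k)` up
to a constant, so the sum is an interpolation at `(abq^m)⁻¹`. -/
lemma skewForm_skewPoly_succ (h : GenericParams a b c q) {L : ℂ[X] →ₗ[ℂ] ℂ}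
    (hL : IsBigQJacobiFunctional a b c q L) (m : ℕ) :
    (1 - q) * ((1 - a) * (1 - c) * ((1 - b) * (1 - a * b / c))) *
        skewForm q L (skewPoly a b c q (m + 1)) (qPochPoly (b / c) q m) =
      qPoch q q (m + 1) * qPoch a q (m + 1) * qPoch c q (m + 1) /
          qPoch (a * b * q ^ m) q (m + 1) *
        ((1 - a * b * q) * (qPoch b q m * qPoch (a * b / c) q m)) *
        ((1 - a * b * q ^ m) / qPoch (a * b * q) q m *
          (skewFactor a b c (a * b * q ^ m)⁻¹ (q ^ m) * (a * b * q ^ m) ^ (m + 1) /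
            qPoch (a * b * q ^ m) q (m + 2))) := by
  obtain ⟨p, hp, hpd⟩ := exists_skewFactor_poly (a := a) (b := b) (q := q) h.c_ne_zero m
  have e1 : a * b * q ^ (m + 1) / q = a * b * q ^ m := by
    rw [div_eq_iff h.q_ne_zero]; ring
  have hx0 : a * b * q ^ m ≠ 0 :=
    mul_ne_zero (mul_ne_zero h.a_ne_zero h.b_ne_zero) (pow_ne_zero m h.q_ne_zero)
  have hxq : ∀ k : ℕ, a * b * q ^ m * q ^ k ≠ 1 := fun k => by
    rw [mul_assoc, ← pow_add]; exact h.ab_mul_ne_one _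
  have hsum := sum_qWeight_mul_eval_div h.q_ne_zero h.q_pow_ne_one (n := m + 1) (p := p)
    (degree_le_natDegree.trans_lt (by exact_mod_cast Nat.lt_succ_of_le hpd)) hx0 hxq
  rw [h.skewForm_skewPoly hL, e1, ← hp, ← hsum]
  congr 1
  rw [Finset.mul_sum]
  refine Finset.sum_congr rfl fun k _ => ?_
  have e3 : qPoch (a * b * q) q (k + m) =
      qPoch (a * b * q) q m * qPoch (a * b * q ^ m * q) q k := by
    rw [add_comm, qPoch_add]
    ring_nf
  have e4 : qPoch (a * b * q ^ m) q k * (1 - a * b * q ^ m * q ^ k) =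
      (1 - a * b * q ^ m) * qPoch (a * b * q ^ m * q) q k := by
    rw [← qPoch_succ, qPoch_succ']
  have n1 : qPoch (a * b * q ^ m * q) q k ≠ 0 := by
    rw [mul_assoc (a * b), ← pow_succ]; exact h.qPoch_ab_ne_zero _ _
  have n2 : 1 - a * b * q ^ m * q ^ k ≠ 0 := sub_ne_zero.2 (hxq k).symm
  have n3 := h.qPoch_ab_ne_zero 1 m
  rw [pow_one] at n3
  rw [e3, ← hp, div_mul_div_comm, div_eq_div_iff (mul_ne_zero n3 n1) (mul_ne_zero n3 n2)]
  linear_combination qWeight q (m + 1) k * p.eval (q ^ k) * qPoch (a * b * q) q m * e4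

theorem skewForm_skewPoly_consecutive (h : GenericParams a b c q) {L : ℂ[X] →ₗ[ℂ] ℂ}
    (hL : IsBigQJacobiFunctional a b c q L) (m : ℕ) :
    skewForm q L (skewPoly a b c q m) (skewPoly a b c q (m + 1)) =
      (-1) ^ m * skewNorm a b c q m := by
  -- Pairing with `P_{m+1}` kills degrees below `m`, so `P_m` may be replaced by `(bX/c;q)_m` up to
  -- its leading coefficient.
  have hlead := linearMap_mul_leadingCoeff h.degree_qPochPoly_div
    (skewForm q L (skewPoly a b c q (m + 1))) m
    (fun j hj => h.skewForm_skewPoly_eq_zero hL (by omega)) (skewPoly a b c q m)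
    (h.degree_skewPoly_le m)
  rw [h.coeff_skewPoly_self, one_mul] at hlead
  have hval := h.skewForm_skewPoly_succ hL m
  rw [← hlead, leadingCoeff_qPochPoly (div_ne_zero h.b_ne_zero h.c_ne_zero) h.q_ne_zero,
    skewFactor_inv h] at hval
  rw [skewForm_skew]
  have ha := h.a_ne_zero
  have hb := h.b_ne_zero
  have hc := h.c_ne_zero
  have hq := h.q_ne_zero
  have hqm := pow_ne_zero m hq
  have hK := h.normalization_ne_zero
  have hG : ∏ i ∈ Finset.range m, (-(b / c * q ^ i)) =
      (-1) ^ m * (b / c) ^ m * ∏ i ∈ Finset.range m, q ^ i := by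
    simp only [neg_mul_eq_neg_mul, Finset.prod_mul_distrib, Finset.prod_const, Finset.card_range]
    rw [neg_pow]
  have hG2 : (∏ i ∈ Finset.range m, q ^ i) ^ 2 * q ^ m = q ^ (m * m) := by
    rw [Finset.prod_pow_eq_pow_sum, ← pow_mul, Finset.sum_range_id_mul_two, ← pow_add]
    congr 1
    rcases m with _ | m
    · rfl
    · simp; ring
  have hG0 : ∏ i ∈ Finset.range m, q ^ i ≠ 0 := Finset.prod_ne_zero_iff.2 fun i _ => pow_ne_zero i hq
  have d1 : qPoch (a * b * q) q m * qPoch (a * b * q ^ m) q (m + 2) =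
      (1 - a * b * q ^ m) * ((1 - a * b * q) * qPoch (a * b * q ^ 2) q (2 * m)) := by
    rw [qPoch_succ' (a * b * q ^ m), mul_left_comm, mul_assoc (a * b) (q ^ m) q, ← pow_succ,
      pow_succ', ← mul_assoc (a * b), ← qPoch_add, show m + (m + 1) = 2 * m + 1 by ring,
      qPoch_succ', mul_assoc (a * b) q q, ← sq]
  have d2 : qPoch (a * b * q ^ m) q (m + 1) =
      qPoch (a * b * q ^ m) q m * (1 - a * b * q ^ m * q ^ m) := qPoch_succ _ _ _
  have n1 := h.qPoch_ab_ne_zero 2 (2 * m)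
  have n2 := h.qPoch_ab_ne_zero m m
  have n3 : 1 - a * b * q ^ m * q ^ m ≠ 0 :=
    sub_ne_zero.2 (by rw [mul_assoc, ← pow_add]; exact (h.ab_mul_ne_one _).symm)
  have n4 : 1 - a * b * q ^ m ≠ 0 := sub_ne_zero.2 (h.ab_mul_ne_one m).symm
  have n5 : 1 - a * b * q ≠ 0 := sub_ne_zero.2 (by simpa using (h.ab_mul_ne_one 1).symm)
  have n6 : 1 - q ≠ 0 := sub_ne_zero.2 h.q_ne_one.symm
  have p1 : qPoch a q (m + 1) = (1 - a) * qPoch (a * q) q m := qPoch_succ' _ _ _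
  have p2 : qPoch c q (m + 1) = (1 - c) * qPoch (c * q) q m := qPoch_succ' _ _ _
  have p3 : qPoch b q m * (1 - b * q ^ m) = (1 - b) * qPoch (b * q) q m := by
    rw [← qPoch_succ, qPoch_succ']
  have p4 : qPoch (a * b / c) q m * (1 - a * b / c * q ^ m) =
      (1 - a * b / c) * qPoch (a * b / c * q) q m := by
    rw [← qPoch_succ, qPoch_succ']
  have hx : (a * b * q ^ m) ^ (m + 1) / (a * b * q ^ m * q ^ m) =
      (a * b) ^ m * (∏ i ∈ Finset.range m, q ^ i) ^ 2 := by
    rw [div_eq_iff (by positivity), mul_pow, ← pow_mul, mul_add, mul_one, pow_add q, ← hG2]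
    ring
  have hrhs : (1 - q) * ((1 - a) * (1 - c) * ((1 - b) * (1 - a * b / c))) *
      (skewForm q L (skewPoly a b c q (m + 1)) (skewPoly a b c q m) *
        ∏ i ∈ Finset.range m, (-(b / c * q ^ i))) =
      (1 - q) * ((1 - a) * (1 - c) * ((1 - b) * (1 - a * b / c))) *
      (-((-1) ^ m * skewNorm a b c q m) * ∏ i ∈ Finset.range m, (-(b / c * q ^ i))) := by
    rw [hval]
    have hrearrange : qPoch q q (m + 1) * qPoch a q (m + 1) * qPoch c q (m + 1) /
          qPoch (a * b * q ^ m) q (m + 1) *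
        ((1 - a * b * q) * (qPoch b q m * qPoch (a * b / c) q m)) *
        ((1 - a * b * q ^ m) / qPoch (a * b * q) q m *
          (-((1 - a * b * q ^ m * q ^ m) * (1 - b * q ^ m) * (1 - a * b / c * q ^ m)) /
            (a * b * q ^ m * q ^ m) * (a * b * q ^ m) ^ (m + 1) /
            qPoch (a * b * q ^ m) q (m + 2))) =
        -(qPoch q q (m + 1) * qPoch a q (m + 1) * qPoch c q (m + 1) /
          qPoch (a * b * q ^ m) q (m + 1) *
        ((1 - a * b * q) * ((qPoch b q m * (1 - b * q ^ m)) *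
          (qPoch (a * b / c) q m * (1 - a * b / c * q ^ m)))) *
        ((1 - a * b * q ^ m) * (1 - a * b * q ^ m * q ^ m) *
          ((a * b * q ^ m) ^ (m + 1) / (a * b * q ^ m * q ^ m)) /
          (qPoch (a * b * q) q m * qPoch (a * b * q ^ m) q (m + 2)))) := by
      simp only [div_eq_mul_inv, mul_inv]
      ring
    rw [hrearrange, d1, d2, p1, p2, p3, p4, hx, hG, skewNorm, ← div_eq_mul_inv (a * b) c]
    have hs : (-1 : ℂ) ^ m * (-1) ^ m = 1 := by rw [← mul_pow]; simp
    have hbc : (a * b) ^ m = (a * c) ^ m * (b / c) ^ m := by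
      rw [← mul_pow]; congr 1; field_simp
    rw [hbc]
    exact skewNorm_rearrangement n3 n4 n5 n6 hs
  have hp : ∏ i ∈ Finset.range m, (-(b / c * q ^ i)) ≠ 0 := by
    rw [hG]
    exact mul_ne_zero (mul_ne_zero (pow_ne_zero _ (by simp))
      (pow_ne_zero _ (div_ne_zero hb hc))) hG0
  rw [mul_right_cancel₀ hp (mul_left_cancel₀ hK hrhs), neg_neg]

/-! ### The Pfaffian as a product of skew norms -/

/-- The coefficient matrix of the polynomials `skewPoly`. -/
noncomputable def _root_.skewPolyMatrix (a b c q : ℂ) (n : ℕ) : Matrix (Fin n) (Fin n) ℂ :=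
  Matrix.of fun i j => (skewPoly a b c q i.1).coeff j.1

lemma det_skewPolyMatrix (h : GenericParams a b c q) (n : ℕ) :
    (skewPolyMatrix a b c q n).det = 1 := by
  rw [Matrix.det_of_isLowerTriangular]
  · exact Finset.prod_eq_one fun i _ => h.coeff_skewPoly_self i.1
  · intro i j hij
    refine coeff_eq_zero_of_degree_lt ((h.degree_skewPoly_le i.1).trans_lt ?_)
    exact_mod_cast hij

lemma skewPoly_eq_sum (h : GenericParams a b c q) {n : ℕ} (i : Fin n) :
    skewPoly a b c q i.1 = ∑ k : Fin n, skewPolyMatrix a b c q n i k • (X ^ k.1 : ℂ[X]) := by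
  have hd : (skewPoly a b c q i.1).natDegree < n :=
    (natDegree_le_of_degree_le (h.degree_skewPoly_le i.1)).trans_lt i.2
  conv_lhs => rw [as_sum_range_C_mul_X_pow' _ hd]
  rw [← Fin.sum_univ_eq_sum_range (fun k => C ((skewPoly a b c q i.1).coeff k) * X ^ k) n]
  exact Finset.sum_congr rfl fun k _ => (smul_eq_C_mul _).symm

theorem pfaffian_bigQJacobiMatrix (h : GenericParams a b c q) (N : ℕ) :
    pfaffian (bigQJacobiMatrix a b c q N) = ∏ k ∈ Finset.range N, skewNorm a b c q (2 * k) := by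
  obtain ⟨L, hL⟩ : ∃ L, IsBigQJacobiFunctional a b c q L :=
    exists_functional h.q_ne_zero h.q_ne_zero _
  have hM : ∀ i j, bigQJacobiMatrix a b c q N i j = skewForm q L (X ^ i.1) (X ^ j.1) :=
    fun i j => by
      rw [skewForm_X_pow, hL.map_X_pow h.q_ne_zero h.q_pow_ne_one]
      rfl
  have hT : ∀ i j, (skewPolyMatrix a b c q (2 * N) * bigQJacobiMatrix a b c q N *
      (skewPolyMatrix a b c q (2 * N)).transpose) i j =
      skewForm q L (skewPoly a b c q i.1) (skewPoly a b c q j.1) := by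
    intro i j
    rw [h.skewPoly_eq_sum i, h.skewPoly_eq_sum j]
    simp only [map_sum, LinearMap.sum_apply, map_smul, LinearMap.smul_apply, smul_eq_mul,
      Matrix.mul_apply, Matrix.transpose_apply, hM, Finset.sum_mul, Finset.mul_sum]
    refine Finset.sum_congr rfl fun l _ => Finset.sum_congr rfl fun k _ => ?_
    ring
  have hlow : ∀ i j : ℕ, j + 2 ≤ i →
      skewForm q L (skewPoly a b c q i) (skewPoly a b c q j) = 0 := fun i j hij =>
    linearMap_eq_zero_of_degree_lt h.degree_qPochPoly_div _ (j + 1)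
      (fun k hk => h.skewForm_skewPoly_eq_zero hL (by omega)) _
      ((h.degree_skewPoly_le j).trans_lt (by exact_mod_cast j.lt_succ_self))
  rw [← one_mul (pfaffian _), ← h.det_skewPolyMatrix (2 * N), ← pfaffian_congruence,
    pfaffian_tridiagonal]
  · rw [← Fin.prod_univ_eq_prod_range (fun k => skewNorm a b c q (2 * k)) N]
    refine Finset.prod_congr rfl fun k _ => ?_
    -- Only even indices occur, so the sign `(-1)^(2k)` disappears.
    rw [hT, h.skewForm_skewPoly_consecutive hL, pow_mul]
    simp
  · intro i j
    rw [hT, hT, skewForm_skew]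
  · intro i j hij hji
    rw [hT]
    rcases lt_trichotomy i.1 j.1 with hlt | heq | hgt
    · rw [skewForm_skew, hlow _ _ (by omega), neg_zero]
    · rw [heq]
      have := skewForm_skew q L (skewPoly a b c q j.1) (skewPoly a b c q j.1)
      exact self_eq_neg.1 this
    · exact hlow _ _ (by omega)

end GenericParams

/-! ### Closed form of the product of norms -/

lemma prod_qPoch_two (y q : ℂ) (n : ℕ) :
    ∏ k ∈ Finset.range n, qPoch (y * q ^ (2 * k)) q 2 = qPoch y q (2 * n) := by
  induction n with
  | zero => rfl
  | succ n ih => rw [Finset.prod_range_succ, ih, ← qPoch_add, mul_add, mul_one]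

/-- The numerators differ by `6 N (2N - 1)`, and `N (2N - 1) = 0 + 1 + ⋯ + (2N - 1)` is the power of
`q` in `skewNorm` at index `2N`. -/
lemma hankelPfaffian_exponent_succ (N : ℕ) :
    (((N + 1 : ℕ) : ℤ) * (((N + 1 : ℕ) : ℤ) - 1) * (4 * ((N + 1 : ℕ) : ℤ) - 5) / 6) =
      (N : ℤ) * ((N : ℤ) - 1) * (4 * (N : ℤ) - 5) / 6 + (N : ℤ) * (2 * N - 1) := by
  rw [← Int.add_mul_ediv_right _ _ (by norm_num : (6 : ℤ) ≠ 0)]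
  congr 1
  push_cast
  ring

lemma prod_range_pow_two_mul {q : ℂ} (N : ℕ) :
    ∏ i ∈ Finset.range (2 * N), q ^ i = q ^ ((N : ℤ) * (2 * N - 1)) := by
  rw [Finset.prod_pow_eq_pow_sum, ← zpow_natCast]
  congr 1
  have := Finset.sum_range_id_mul_two (2 * N)
  rcases N with _ | N
  · rfl
  · rw [show 2 * (N + 1) - 1 = 2 * N + 1 by omega] at this
    zify at this
    push_cast at this ⊢
    linarith

/-- The right-hand side of the evaluation. -/
noncomputable def hankelPfaffianValue (a b c q : ℂ) (N : ℕ) : ℂ :=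
  (a * c) ^ (N * (N - 1)) * q ^ ((N : ℤ) * ((N : ℤ) - 1) * (4 * (N : ℤ) - 5) / 6) *
    ∏ k ∈ Finset.range N,
      (qPoch q q (2 * k + 1) *
          (qPoch (a * q) q (2 * k) * qPoch (b * q) q (2 * k) * qPoch (c * q) q (2 * k) *
            qPoch (a * b * c⁻¹ * q) q (2 * k))) /
        ((1 - q) * qPoch (a * b * q ^ 2) q (2 * (k + N) - 2))

/-- Passing from `N` to `N + 1` adds two factors to each old denominator; over `k < N` they
concatenate to `(abq^(2N);q)_{2N}`. -/
lemma prod_qPoch_shift (a b q : ℂ) (N : ℕ) :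
    ∏ k ∈ Finset.range (N + 1), qPoch (a * b * q ^ 2) q (2 * (k + (N + 1)) - 2) =
      (∏ k ∈ Finset.range N, qPoch (a * b * q ^ 2) q (2 * (k + N) - 2)) *
        (qPoch (a * b * q ^ 2) q (2 * (2 * N)) * qPoch (a * b * q ^ (2 * N)) q (2 * N)) := by
  rw [Finset.prod_range_succ, show 2 * (N + (N + 1)) - 2 = 2 * (2 * N) by omega,
    ← prod_qPoch_two (a * b * q ^ (2 * N)), mul_comm (qPoch _ q (2 * (2 * N))),
    ← mul_assoc (Finset.prod _ _), ← Finset.prod_mul_distrib]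
  congr 1
  refine Finset.prod_congr rfl fun k hk => ?_
  have := Finset.mem_range.1 hk
  -- Since `k < N`, `N` is positive and the subtraction of `2` is not truncated.
  rw [show 2 * (k + (N + 1)) - 2 = (2 * (k + N) - 2) + 2 by omega, qPoch_add]
  congr 2
  rw [mul_assoc, mul_assoc (a * b), ← pow_add, ← pow_add]
  congr 2
  omega

theorem GenericParams.prod_skewNorm {a b c q : ℂ} (h : GenericParams a b c q) (N : ℕ) :
    ∏ k ∈ Finset.range N, skewNorm a b c q (2 * k) = hankelPfaffianValue a b c q N := by
  induction N with
  | zero => simp [hankelPfaffianValue]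
  | succ N ih =>
    rw [Finset.prod_range_succ, ih, hankelPfaffianValue, hankelPfaffianValue,
      hankelPfaffian_exponent_succ, zpow_add₀ h.q_ne_zero, Finset.prod_div_distrib,
      Finset.prod_div_distrib, Finset.prod_mul_distrib (f := fun _ => 1 - q),
      Finset.prod_mul_distrib (f := fun _ => 1 - q), prod_qPoch_shift, Finset.prod_range_succ,
      Finset.prod_range_succ, skewNorm, prod_range_pow_two_mul,
      show (N + 1) * (N + 1 - 1) = N * (N - 1) + 2 * N by
        rcases N with _ | N
        · rfl
        · simp; ring, pow_add (a * c)]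
    simp only [div_eq_mul_inv, mul_inv]
    ring

/-! ### Removing genericity by continuity -/

lemma continuousAt_qPoch {f : ℂ → ℂ} {t : ℂ} (hf : ContinuousAt f t) (q : ℂ) (n : ℕ) :
    ContinuousAt (fun t => qPoch (f t) q n) t := by
  unfold qPoch
  fun_prop

lemma qPoch_ab_ne_zero_of_forall {a b q : ℂ} {n : ℕ}
    (hab : ∀ k : ℕ, 2 ≤ k → k < n + 2 → a * b * q ^ k ≠ 1) : qPoch (a * b * q ^ 2) q n ≠ 0 :=
  qPoch_ne_zero fun k hk => by
    rw [mul_assoc, ← pow_add]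
    exact hab _ (by omega) (by omega)

lemma continuousAt_bigQJacobiSum {a b c q : ℂ} {n : ℕ}
    (hab : ∀ k : ℕ, 2 ≤ k → k < n + 2 → a * b * q ^ k ≠ 1) :
    ContinuousAt (fun t => bigQJacobiSum (a + t) (b + t) (c + t) q n) 0 := by
  unfold bigQJacobiSum
  refine tendsto_finsetSum _ fun m hm => ?_
  have hm := Finset.mem_range.1 hm
  refine ContinuousAt.mul continuousAt_const (ContinuousAt.div ?_ ?_ ?_)
  · exact (continuousAt_qPoch (by fun_prop) q m).mul (continuousAt_qPoch (by fun_prop) q m)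
  · exact continuousAt_qPoch (by fun_prop) q m
  · simp only [add_zero]
    exact qPoch_ab_ne_zero_of_forall fun k h1 h2 => hab k h1 (by omega)

lemma continuousAt_pfaffian {N : ℕ} {A : ℂ → Matrix (Fin (2 * N)) (Fin (2 * N)) ℂ} {t : ℂ}
    (hA : ∀ i j, ContinuousAt (fun t => A t i j) t) :
    ContinuousAt (fun t => pfaffian (A t)) t := by
  unfold pfaffian
  refine continuousAt_const.mul (tendsto_finsetSum _ fun σ _ => ?_)
  exact continuousAt_const.mul (tendsto_finsetProd _ fun i _ => hA _ _)

lemma continuousAt_bigQJacobiMatrix {N : ℕ} {a b c q : ℂ}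
    (hab : ∀ k : ℕ, 2 ≤ k → k + 3 ≤ 4 * N → a * b * q ^ k ≠ 1) (i j : Fin (2 * N)) :
    ContinuousAt (fun t => bigQJacobiMatrix (a + t) (b + t) (c + t) q N i j) 0 := by
  simp only [bigQJacobiMatrix, Matrix.of_apply]
  -- Off the diagonal `i + j - 1 ≤ 4N - 4`, so the denominators only reach `1 - abq^(4N-3)`. The
  -- diagonal could go further, but its entries are identically zero.
  rcases eq_or_ne i j with rfl | hij
  · simp only [sub_self, zero_mul]
    exact continuousAt_const
  · have hij' : i.1 ≠ j.1 := fun e => hij (Fin.ext e)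
    exact continuousAt_const.mul (continuousAt_bigQJacobiSum fun k h1 h2 =>
      hab k h1 (by omega))

lemma continuousAt_hankelPfaffianValue {N : ℕ} {a b c q : ℂ} (hc : c ≠ 0) (hq1 : q ≠ 1)
    (hab : ∀ k : ℕ, 2 ≤ k → k + 3 ≤ 4 * N → a * b * q ^ k ≠ 1) :
    ContinuousAt (fun t => hankelPfaffianValue (a + t) (b + t) (c + t) q N) 0 := by
  have hc' : c + 0 ≠ 0 := by simpa using hc
  unfold hankelPfaffianValue
  refine ContinuousAt.mul (by fun_prop) (tendsto_finsetProd _ fun k hk => ?_)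
  have hk := Finset.mem_range.1 hk
  have hpoch : ∀ f : ℂ → ℂ, ContinuousAt f 0 → ∀ n, ContinuousAt (fun t => qPoch (f t) q n) 0 :=
    fun f hf n => continuousAt_qPoch hf q n
  refine ContinuousAt.div (continuousAt_const.mul ?_) (continuousAt_const.mul ?_)
    (mul_ne_zero (sub_ne_zero.2 hq1.symm) ?_)
  · exact (((hpoch _ (by fun_prop) _).mul (hpoch _ (by fun_prop) _)).mul
      (hpoch _ (by fun_prop) _)).mul (hpoch _ (by fun_prop (disch := assumption)) _)
  · exact hpoch _ (by fun_prop) _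
  · simp only [add_zero]
    exact qPoch_ab_ne_zero_of_forall fun k h1 h2 => hab k h1 (by omega)

lemma countable_quadratic_zeros (u p r : ℂ) (hu : u ≠ 0) :
    {t : ℂ | u * t ^ 2 + p * t + r = 0}.Countable := by
  have hne : C u * X ^ 2 + C p * X + C r ≠ 0 := by
    rw [← leadingCoeff_ne_zero, leadingCoeff_quadratic hu]
    exact hu
  refine ((C u * X ^ 2 + C p * X + C r).rootSet_finite ℂ).countable.mono fun t ht => ?_
  rw [mem_rootSet]
  exact ⟨hne, by simpa using ht⟩

/-- Each excluded equality is a nonzero polynomial equation in `t` of degree at most two, and there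
are countably many of them. -/
lemma countable_not_genericParams {a b c q : ℂ} (hq0 : q ≠ 0)
    (hq : ∀ k : ℕ, q ^ (k + 1) ≠ 1) :
    {t : ℂ | ¬ GenericParams (a + t) (b + t) (c + t) q}.Countable := by
  have hlin : ∀ x y : ℂ, {t : ℂ | x + t = y}.Countable := fun x y =>
    (Set.countable_singleton (y - x)).mono fun t ht => by
      simp only [Set.mem_ofPred_eq] at ht
      simp [← ht]
  have hquad : {t : ℂ | (a + t) * (b + t) = c + t}.Countable :=
    (countable_quadratic_zeros 1 (a + b - 1) (a * b - c) one_ne_zero).mono fun t ht => by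
      simp only [Set.mem_ofPred_eq] at ht ⊢
      linear_combination ht
  have hquad' : ∀ k : ℕ, {t : ℂ | (a + t) * (b + t) * q ^ k = 1}.Countable := fun k =>
    (countable_quadratic_zeros (q ^ k) ((a + b) * q ^ k) (a * b * q ^ k - 1)
      (pow_ne_zero k hq0)).mono fun t ht => by
        simp only [Set.mem_ofPred_eq] at ht ⊢
        linear_combination ht
  have hlin' : ∀ x : ℂ, ∀ k : ℕ, {t : ℂ | (x + t) * q ^ k = 1}.Countable := fun x k =>
    (hlin x (q ^ k)⁻¹).mono fun t ht => eq_inv_of_mul_eq_one_left ht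
  refine (((hlin a 0).union (hlin b 0)).union (((hlin c 0).union (hlin b 1)).union
    ((hquad.union (Set.countable_iUnion hquad')).union
      ((Set.countable_iUnion (hlin' a)).union (Set.countable_iUnion (hlin' c)))))).mono
    fun t ht => ?_
  by_contra hcon
  simp only [Set.mem_union, Set.mem_iUnion, Set.mem_ofPred_eq, not_or, not_exists] at hcon
  obtain ⟨⟨h1, h2⟩, ⟨h3, h4⟩, ⟨h5, h6⟩, h7, h8⟩ := hcon
  exact ht ⟨hq0, hq, h1, h2, h3, h7, h8, h4, h5, h6⟩

/-- Evaluation of the big `q`-Jacobi `q`-Catalan–Hankel Pfaffian. The exponent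
`N(N-1)(4N-5)/6` is an integer, so the integer division is exact. -/
theorem mainTheorem4 (N : ℕ) (a b c q : ℂ) (hq0 : 0 < ‖q‖) (hq1 : ‖q‖ < 1) (hc : c ≠ 0)
    (hab : ∀ k : ℕ, 2 ≤ k → k + 3 ≤ 4 * N → a * b * q ^ k ≠ 1) :
    pfaffian (bigQJacobiMatrix a b c q N) =
      (a * c) ^ (N * (N - 1)) * q ^ ((N : ℤ) * ((N : ℤ) - 1) * (4 * (N : ℤ) - 5) / 6) *
        ∏ k ∈ Finset.range N,
          (qPoch q q (2 * k + 1) *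
              (qPoch (a * q) q (2 * k) * qPoch (b * q) q (2 * k) * qPoch (c * q) q (2 * k) *
                qPoch (a * b * c⁻¹ * q) q (2 * k))) /
            ((1 - q) * qPoch (a * b * q ^ 2) q (2 * (k + N) - 2)) := by
  have hq0' : q ≠ 0 := norm_pos_iff.1 hq0
  have hq : ∀ k : ℕ, q ^ (k + 1) ≠ 1 := fun k h => by
    have := pow_lt_one₀ hq0.le hq1 k.succ_ne_zero
    rw [← norm_pow, h, norm_one] at this
    exact this.false
  have hdense : Dense {t : ℂ | GenericParams (a + t) (b + t) (c + t) q} := by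
    have := (countable_not_genericParams (a := a) (b := b) (c := c) hq0' hq).dense_compl ℂ
    simpa only [Set.compl_ofPred, not_not] using this
  -- Density makes `0` a limit of generic `t`, so limits along them are unique.
  have : (nhdsWithin (0 : ℂ) {t : ℂ | GenericParams (a + t) (b + t) (c + t) q}).NeBot :=
    mem_closure_iff_nhdsWithin_neBot.1 (hdense 0)
  have h1 : ContinuousAt (fun t => pfaffian (bigQJacobiMatrix (a + t) (b + t) (c + t) q N)) 0 :=
    continuousAt_pfaffian (continuousAt_bigQJacobiMatrix hab)
  have h2 := continuousAt_hankelPfaffianValue (N := N) hc (by simpa using hq 0) hab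
  have heq : ∀ t ∈ {t : ℂ | GenericParams (a + t) (b + t) (c + t) q},
      pfaffian (bigQJacobiMatrix (a + t) (b + t) (c + t) q N) =
        hankelPfaffianValue (a + t) (b + t) (c + t) q N := fun t ht => by
    have ht : GenericParams (a + t) (b + t) (c + t) q := ht
    rw [ht.pfaffian_bigQJacobiMatrix, ht.prod_skewNorm]
  have h3 := tendsto_nhds_unique_of_eventuallyEq
    (l := nhdsWithin (0 : ℂ) {t : ℂ | GenericParams (a + t) (b + t) (c + t) q})
    (h1.tendsto.mono_left nhdsWithin_le_nhds) (h2.tendsto.mono_left nhdsWithin_le_nhds)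
    (Filter.eventually_of_mem self_mem_nhdsWithin heq)
  simpa only [add_zero, hankelPfaffianValue] using h3
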